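/- Let $\mathbb N^\times$ be the multiplicative monoid of integers $k\ge 1$, viewed as a category with one object, and let $\widehat{\mathbb N^\times}$ be the topos of presheaves of sets on it, i.e. of sets with an action of $\mathbb N^\times$. A point $\mathfrak p$ of this topos is given by a flat (filtering) functor $\mathbb N^\times\to\mathfrak{Sets}$, i.e. by a non-empty set $X$ with an action $F$ of $\mathbb N^\times$ such that any $x,x'\in X$ are of the form $x=F(k)z$, $x'=F(k')z$ for some $z \in X$ and $k,k'\in\mathbb N^\times$, and such that $F(k)x=F(k')x$ implies $k=k'$; isomorphisms of points are equivariant bijections. The stalk of an object $Y$ at $\mathfrak p$ is the filtered colimit $(Y\times X)/\sim$, where $\sim$ is the equivalence relation generated by $(y,F(k)x)\sim(k\cdot y,x)$. Let $\mathcal K$ be the $C^*$-algebra of compact operators on $\ell^2(\mathbb Z)$, with canonical basis $(\delta_n)_{n\in\mathbb Z}$, on which $k\in\mathbb N^\times$ acts by $\mathrm{Fr}_k(x)=\sum_{0\le j<k}u(k,j)\,x\,u(k,j)^*$, where $u(k,j)$ is the isometry of $\ell^2(\mathbb Z)$ with $u(k,j)\delta_n=\delta_{kn+j}$. An involutive complex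 algebra $A$ is called a pre-$C^*$-algebra if $$\|x\|:=\sup\{|\lambda|^{1/2} : \lambda\in\mathbb C,\ x^*x-\lambda\ \text{is not invertible in}\ A\oplus\mathbb C\}$$ (where $A\oplus\mathbb C$ is $A$ with a unit adjoined) defines a norm on $A$ whose completion is a $C^*$-algebra. A $C^*$-algebra is called matroid if it is an inductive limit of full matrix algebras $M_n(\mathbb C)$, $n\ge 1$, i.e. if it has a directed family of $*$-subalgebras, each isomorphic to some $M_n(\mathbb C)$ (and not required to share a unit), whose union is dense. A matroid $C^*$-algebra is called infinite if it has no non-zero bounded trace, i.e. no non-zero bounded positive linear functional $\tau$ with $\tau(ab)=\tau(ba)$ for all $a,b$. Then: (i) With the usual sum, scalar multiples, product and adjoint of compact operators, $\mathcal K$ is an involutive algebra in the topos $\widehat{\mathbb N^\times}$. (ii) For every point $\mathfrak p$ of $\widehat{\mathbb N^\times}$, the stalk of $\mathcal K$ at $\mathfrak p$, with the induced structure of involutive algebra, is a pre-$C^*$-algebra, and its completion $\mathcal K_{\mathfrak p}$ is an infinite separable matroid $C^*$-algebra. (iii) For every infinite separable matroid $C^*$-algebra $A$ there is a point $\mathfrak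 p$ of $\widehat{\mathbb N^\times}$, unique up to isomorphism, such that $\mathcal K_{\mathfrak p}$ is isomorphic to $A$. -/

import Mathlib

universe w v u

section InternalAlgebra

open CategoryTheory MonoidalCategory CartesianMonoidalCategory

/-! ### Involutive algebras in a category with finite products -/

/-- An involutive (associative, not necessarily unital) complex algebra internal to a category
with finite products. The scalars act through one endomorphism `smul c` for every `c : ℂ`; in a
topos this is the same as an action of the constant object `ℂ`, which is a sum of copies of the
terminal object. The identities are stated on generalized elements `T ⟶ X`. -/
structure InvolutiveAlgebraObj {𝓔 : Type u} [Category.{v} 𝓔] [CartesianMonoidalCategory 𝓔]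
    (X : 𝓔) where
  zero : 𝟙_ 𝓔 ⟶ X
  add : X ⊗ X ⟶ X
  neg : X ⟶ X
  smul : ℂ → (X ⟶ X)
  mul : X ⊗ X ⟶ X
  star : X ⟶ X
  add_assoc : ∀ {T : 𝓔} (f g h : T ⟶ X),
    lift (lift f g ≫ add) h ≫ add = lift f (lift g h ≫ add) ≫ add
  add_comm : ∀ {T : 𝓔} (f g : T ⟶ X), lift f g ≫ add = lift g f ≫ add
  zero_add : ∀ {T : 𝓔} (f : T ⟶ X), lift (toUnit T ≫ zero) f ≫ add = f
  neg_add_cancel : ∀ {T : 𝓔} (f : T ⟶ X), lift (f ≫ neg) f ≫ add = toUnit T ≫ zero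
  one_smul : smul 1 = 𝟙 X
  mul_smul : ∀ c d : ℂ, smul (c * d) = smul d ≫ smul c
  smul_add : ∀ (c : ℂ) {T : 𝓔} (f g : T ⟶ X),
    lift f g ≫ add ≫ smul c = lift (f ≫ smul c) (g ≫ smul c) ≫ add
  add_smul : ∀ (c d : ℂ) {T : 𝓔} (f : T ⟶ X),
    f ≫ smul (c + d) = lift (f ≫ smul c) (f ≫ smul d) ≫ add
  mul_assoc : ∀ {T : 𝓔} (f g h : T ⟶ X),
    lift (lift f g ≫ mul) h ≫ mul = lift f (lift g h ≫ mul) ≫ mul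
  left_distrib : ∀ {T : 𝓔} (f g h : T ⟶ X),
    lift f (lift g h ≫ add) ≫ mul = lift (lift f g ≫ mul) (lift f h ≫ mul) ≫ add
  right_distrib : ∀ {T : 𝓔} (f g h : T ⟶ X),
    lift (lift f g ≫ add) h ≫ mul = lift (lift f h ≫ mul) (lift g h ≫ mul) ≫ add
  smul_mul : ∀ (c : ℂ) {T : 𝓔} (f g : T ⟶ X),
    lift (f ≫ smul c) g ≫ mul = lift f g ≫ mul ≫ smul c
  mul_smul_comm : ∀ (c : ℂ) {T : 𝓔} (f g : T ⟶ X),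
    lift f (g ≫ smul c) ≫ mul = lift f g ≫ mul ≫ smul c
  star_star : star ≫ star = 𝟙 X
  star_add : ∀ {T : 𝓔} (f g : T ⟶ X),
    lift f g ≫ add ≫ star = lift (f ≫ star) (g ≫ star) ≫ add
  star_mul : ∀ {T : 𝓔} (f g : T ⟶ X),
    lift f g ≫ mul ≫ star = lift (g ≫ star) (f ≫ star) ≫ mul
  star_smul : ∀ c : ℂ, smul c ≫ star = star ≫ smul (starRingEnd ℂ c)

namespace InvolutiveAlgebraObj

variable {𝓔 : Type u} [Category.{v} 𝓔] [CartesianMonoidalCategory 𝓔] {X : 𝓔}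

/-- The set `F(X)`, where `X` is an internal involutive algebra and `F` is a set-valued functor
which preserves finite products. It carries the involutive algebra structure below. -/
@[nolint unusedArguments]
def Fiber (_S : InvolutiveAlgebraObj X) (F : 𝓔 ⥤ Type w) [F.Monoidal] : Type w := F.obj X

/-- The binary operation on `F(X)` induced by a morphism `X ⊗ X ⟶ X`, through the
identification of `F(X ⊗ X)` with `F(X) × F(X)`. -/
def binop (F : 𝓔 ⥤ Type w) [F.Monoidal] (m : X ⊗ X ⟶ X) (s t : F.obj X) : F.obj X :=
  F.map m (Functor.LaxMonoidal.μ F X X (s, t))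

variable (F : 𝓔 ⥤ Type w) [F.Monoidal]

lemma binop_map (m : X ⊗ X ⟶ X) {T : 𝓔} (f g : T ⟶ X) (e : F.obj T) :
    binop F m (F.map f e) (F.map g e) = F.map (lift f g ≫ m) e := by
  have h := Functor.Monoidal.lift_μ F f g
  have h2 := congrArg (fun k => k e) h
  simp only [Functor.map_comp]
  rw [← h]
  rfl

lemma exists_rep₂ (s t : F.obj X) :
    ∃ (T : 𝓔) (f g : T ⟶ X) (e : F.obj T), F.map f e = s ∧ F.map g e = t := by
  refine ⟨X ⊗ X, fst X X, snd X X, Functor.LaxMonoidal.μ F X X (s, t), ?_, ?_⟩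
  · exact congrArg (fun k => k (s, t)) (Functor.Monoidal.μ_fst F X X)
  · exact congrArg (fun k => k (s, t)) (Functor.Monoidal.μ_snd F X X)

lemma exists_rep₃ (r s t : F.obj X) :
    ∃ (T : 𝓔) (f g h : T ⟶ X) (e : F.obj T),
      F.map f e = r ∧ F.map g e = s ∧ F.map h e = t := by
  obtain ⟨T, f, g, e, rfl, rfl⟩ := exists_rep₂ F r s
  refine ⟨T ⊗ X, fst T X ≫ f, fst T X ≫ g, snd T X, Functor.LaxMonoidal.μ F T X (e, t), ?_, ?_, ?_⟩
  · have := congrArg (fun k => k (e, t)) (Functor.Monoidal.μ_fst F T X)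
    simp only [Functor.map_comp]
    exact congrArg (F.map f) this
  · have := congrArg (fun k => k (e, t)) (Functor.Monoidal.μ_fst F T X)
    simp only [Functor.map_comp]
    exact congrArg (F.map g) this
  · exact congrArg (fun k => k (e, t)) (Functor.Monoidal.μ_snd F T X)


variable (S : InvolutiveAlgebraObj X)

instance : Zero (S.Fiber F) := ⟨F.map S.zero (Functor.LaxMonoidal.ε F PUnit.unit)⟩
instance : Add (S.Fiber F) := ⟨binop F S.add⟩
instance : Neg (S.Fiber F) := ⟨F.map S.neg⟩
instance : Mul (S.Fiber F) := ⟨binop F S.mul⟩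
instance : SMul ℂ (S.Fiber F) := ⟨fun c => F.map (S.smul c)⟩
instance : Star (S.Fiber F) := ⟨F.map S.star⟩

/-- The element of `F(X)` which is the image of `e ∈ F(T)` by a generalized element `T ⟶ X`. -/
def el {T : 𝓔} (f : T ⟶ X) (e : F.obj T) : S.Fiber F := F.map f e

lemma fiber_rep₂ (s t : S.Fiber F) :
    ∃ (T : 𝓔) (f g : T ⟶ X) (e : F.obj T), S.el F f e = s ∧ S.el F g e = t :=
  exists_rep₂ F s t

lemma fiber_rep₃ (r s t : S.Fiber F) :
    ∃ (T : 𝓔) (f g h : T ⟶ X) (e : F.obj T),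
      S.el F f e = r ∧ S.el F g e = s ∧ S.el F h e = t :=
  exists_rep₃ F r s t

lemma fiber_zero {T : 𝓔} (e : F.obj T) :
    (0 : S.Fiber F) = S.el F (toUnit T ≫ S.zero) e := by
  have h : F.map (toUnit T) e = Functor.LaxMonoidal.ε F PUnit.unit := by
    have h1 : Function.Injective (Functor.OplaxMonoidal.η F) :=
      (mono_iff_injective _).1 inferInstance
    exact h1 (Subsingleton.elim (α := PUnit) _ _)
  change F.map S.zero _ = _
  unfold el
  rw [← h, Functor.map_comp]
  rfl

lemma fiber_add {T : 𝓔} (f g : T ⟶ X) (e : F.obj T) :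
    S.el F f e + S.el F g e = S.el F (lift f g ≫ S.add) e := binop_map F S.add f g e

lemma fiber_mul {T : 𝓔} (f g : T ⟶ X) (e : F.obj T) :
    S.el F f e * S.el F g e = S.el F (lift f g ≫ S.mul) e := binop_map F S.mul f g e

lemma fiber_neg {T : 𝓔} (f : T ⟶ X) (e : F.obj T) :
    -S.el F f e = S.el F (f ≫ S.neg) e := by
  unfold el; rw [Functor.map_comp]; rfl

lemma fiber_smul (c : ℂ) {T : 𝓔} (f : T ⟶ X) (e : F.obj T) :
    c • S.el F f e = S.el F (f ≫ S.smul c) e := by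
  unfold el; rw [Functor.map_comp]; rfl

lemma fiber_star {T : 𝓔} (f : T ⟶ X) (e : F.obj T) :
    Star.star (S.el F f e) = S.el F (f ≫ S.star) e := by
  unfold el; rw [Functor.map_comp]; rfl

protected lemma fiber_add_comm (s t : S.Fiber F) : s + t = t + s := by
  obtain ⟨T, f, g, e, rfl, rfl⟩ := S.fiber_rep₂ F s t
  rw [fiber_add, fiber_add, S.add_comm]

protected lemma fiber_zero_add (s : S.Fiber F) : 0 + s = s := by
  obtain ⟨T, f, g, e, rfl, -⟩ := S.fiber_rep₂ F s s
  rw [fiber_zero F S e, fiber_add, S.zero_add]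

protected lemma fiber_neg_add_cancel (s : S.Fiber F) : -s + s = 0 := by
  obtain ⟨T, f, g, e, rfl, -⟩ := S.fiber_rep₂ F s s
  rw [fiber_zero F S e, fiber_neg, fiber_add, S.neg_add_cancel]

protected lemma fiber_left_distrib (r s t : S.Fiber F) : r * (s + t) = r * s + r * t := by
  obtain ⟨T, f, g, h, e, rfl, rfl, rfl⟩ := S.fiber_rep₃ F r s t
  simp only [fiber_add, fiber_mul, S.left_distrib]

protected lemma fiber_right_distrib (r s t : S.Fiber F) : (r + s) * t = r * t + s * t := by
  obtain ⟨T, f, g, h, e, rfl, rfl, rfl⟩ := S.fiber_rep₃ F r s t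
  simp only [fiber_add, fiber_mul, S.right_distrib]

instance : AddCommGroup (S.Fiber F) where
  add_assoc r s t := by
    obtain ⟨T, f, g, h, e, rfl, rfl, rfl⟩ := S.fiber_rep₃ F r s t
    simp only [fiber_add, S.add_assoc]
  zero_add := S.fiber_zero_add F
  add_zero s := by rw [S.fiber_add_comm F, S.fiber_zero_add F]
  neg_add_cancel := S.fiber_neg_add_cancel F
  add_comm := S.fiber_add_comm F
  nsmul := nsmulRec
  zsmul := zsmulRec

instance : NonUnitalRing (S.Fiber F) where
  left_distrib := S.fiber_left_distrib F
  right_distrib := S.fiber_right_distrib F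
  zero_mul s := by
    have h := S.fiber_right_distrib F 0 0 s
    rwa [_root_.add_zero, left_eq_add] at h
  mul_zero s := by
    have h := S.fiber_left_distrib F s 0 0
    rwa [_root_.add_zero, left_eq_add] at h
  mul_assoc r s t := by
    obtain ⟨T, f, g, h, e, rfl, rfl, rfl⟩ := S.fiber_rep₃ F r s t
    simp only [fiber_mul, S.mul_assoc]

protected lemma fiber_smul_add (c : ℂ) (s t : S.Fiber F) : c • (s + t) = c • s + c • t := by
  obtain ⟨T, f, g, e, rfl, rfl⟩ := S.fiber_rep₂ F s t
  simp only [fiber_add, fiber_smul, Category.assoc, S.smul_add]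

protected lemma fiber_add_smul (c d : ℂ) (s : S.Fiber F) : (c + d) • s = c • s + d • s := by
  obtain ⟨T, f, g, e, rfl, -⟩ := S.fiber_rep₂ F s s
  simp only [fiber_add, fiber_smul, S.add_smul]

instance : Module ℂ (S.Fiber F) where
  one_smul s := by
    change F.map (S.smul 1) s = s
    rw [S.one_smul, F.map_id]; rfl
  mul_smul c d s := by
    change F.map (S.smul (c * d)) s = F.map (S.smul c) (F.map (S.smul d) s)
    rw [S.mul_smul, F.map_comp]; rfl
  smul_zero c := by
    have h := S.fiber_smul_add F c 0 0
    rwa [_root_.add_zero, left_eq_add] at h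
  smul_add := S.fiber_smul_add F
  add_smul := S.fiber_add_smul F
  zero_smul s := by
    have h := S.fiber_add_smul F 0 0 s
    rwa [_root_.add_zero, left_eq_add] at h

instance : IsScalarTower ℂ (S.Fiber F) (S.Fiber F) where
  smul_assoc c s t := by
    obtain ⟨T, f, g, e, rfl, rfl⟩ := S.fiber_rep₂ F s t
    simp only [smul_eq_mul, fiber_mul, fiber_smul, Category.assoc, S.smul_mul]

instance : SMulCommClass ℂ (S.Fiber F) (S.Fiber F) where
  smul_comm c s t := by
    obtain ⟨T, f, g, e, rfl, rfl⟩ := S.fiber_rep₂ F s t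
    simp only [smul_eq_mul, fiber_mul, fiber_smul, Category.assoc, S.mul_smul_comm]

instance : StarRing (S.Fiber F) where
  star_involutive s := by
    change F.map S.star (F.map S.star s) = s
    have h := congrArg (fun k => F.map k s) S.star_star
    rw [F.map_comp, F.map_id] at h
    exact h
  star_mul s t := by
    obtain ⟨T, f, g, e, rfl, rfl⟩ := S.fiber_rep₂ F s t
    simp only [fiber_mul, fiber_star, Category.assoc, S.star_mul]
  star_add s t := by
    obtain ⟨T, f, g, e, rfl, rfl⟩ := S.fiber_rep₂ F s t
    simp only [fiber_add, fiber_star, Category.assoc, S.star_add]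

instance : StarModule ℂ (S.Fiber F) where
  star_smul c s := by
    change F.map S.star (F.map (S.smul c) s) = F.map (S.smul (starRingEnd ℂ c)) (F.map S.star s)
    have h := congrArg (fun k => F.map k s) (S.star_smul c)
    rw [F.map_comp, F.map_comp] at h
    exact h

end InvolutiveAlgebraObj

end InternalAlgebra

section Topos

open CategoryTheory

/-- The points of the topos of presheaves of sets on the one-object category with endomorphism
monoid `ℕ^×`, the multiplicative monoid of positive integers. Presheaves are the sheaves for the
trivial topology `⊥`, and a point is given by its fiber functor, a flat (filtering) functor from
the one-object category to sets. -/
abbrev NTimesPoint : Type 1 :=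
  GrothendieckTopology.Point.{0} (⊥ : GrothendieckTopology (SingleObj ℕ+))

/-- The stalk at a point of the topos (the value of the inverse image functor of the point) of an
internal involutive algebra; it is an involutive complex algebra. -/
noncomputable abbrev InvolutiveAlgebraObj.Stalk {P : (SingleObj ℕ+)ᵒᵖ ⥤ Type}
    (S : InvolutiveAlgebraObj P) (p : NTimesPoint) : Type :=
  S.Fiber p.presheafFiber

end Topos

/-! ### The compact operators on `ℓ²(ℤ)` and the endomorphisms `Fr_k` -/

/-- The Hilbert space `ℓ²(ℤ)`. -/
abbrev EllTwoZ : Type := lp (fun _ : ℤ => ℂ) 2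

/-- The canonical orthonormal basis `δ_n` of `ℓ²(ℤ)`. -/
noncomputable def basisVec (n : ℤ) : EllTwoZ := lp.single 2 n 1

lemma orthonormal_basisVec : Orthonormal ℂ basisVec := by
  rw [orthonormal_iff_ite]
  intro i j
  simp only [basisVec]
  rw [lp.inner_single_left]
  by_cases h : i = j
  · subst h; simp
  · simp [lp.single_apply, h]

lemma orthonormal_shift (k : ℕ+) (j : ℕ) :
    Orthonormal ℂ fun n : ℤ => basisVec ((k : ℤ) * n + j) :=
  orthonormal_basisVec.comp _ fun a b h => by
    have hk : (k : ℤ) ≠ 0 := by exact_mod_cast k.ne_zero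
    simpa [hk] using h

/-- The isometry `u(k,j)` of `ℓ²(ℤ)` with `u(k,j) δ_n = δ_{kn+j}`. -/
noncomputable def isom (k : ℕ+) (j : ℕ) : EllTwoZ →ₗᵢ[ℂ] EllTwoZ :=
  (orthonormal_shift k j).orthogonalFamily.linearIsometry

lemma isom_basisVec (k : ℕ+) (j : ℕ) (n : ℤ) :
    isom k j (basisVec n) = basisVec ((k : ℤ) * n + j) := by
  simp only [isom]
  rw [basisVec, OrthogonalFamily.linearIsometry_apply_single]
  simp

/-- `u(k,j)` as a bounded operator. -/
noncomputable def isomCLM (k : ℕ+) (j : ℕ) : EllTwoZ →L[ℂ] EllTwoZ :=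
  (isom k j).toContinuousLinearMap

/-- The operator `Fr_k(x) = ∑_{0 ≤ j < k} u(k,j) x u(k,j)^*`. -/
noncomputable def frobK (k : ℕ+) (x : EllTwoZ →L[ℂ] EllTwoZ) : EllTwoZ →L[ℂ] EllTwoZ :=
  ∑ j ∈ Finset.range k,
    (isomCLM k j).comp (x.comp (ContinuousLinearMap.adjoint (isomCLM k j)))

/-- The set `𝒦` of compact operators on `ℓ²(ℤ)`, a linear subspace of the bounded operators. -/
noncomputable abbrev CompactOps : Submodule ℂ (EllTwoZ →L[ℂ] EllTwoZ) :=
  compactOperator (RingHom.id ℂ) EllTwoZ EllTwoZ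

lemma frobK_mem (k : ℕ+) (x : CompactOps) : frobK k x ∈ CompactOps :=
  Submodule.sum_mem _ fun j _ => (x.2.comp_clm _).clm_comp (isomCLM k j)

lemma ellTwoZ_ext {f g : EllTwoZ →L[ℂ] EllTwoZ} (h : ∀ n, f (basisVec n) = g (basisVec n)) :
    f = g := by
  ext1 v
  have hv := lp.hasSum_single (E := fun _ : ℤ => ℂ) (p := 2) (by norm_num) v
  have e : ∀ n, lp.single (E := fun _ : ℤ => ℂ) 2 n (v n) = v n • basisVec n := by
    intro n
    rw [basisVec, ← lp.single_smul]
    simp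
  have h1 := hv.mapL f
  have h2 := hv.mapL g
  simp only [e, map_smul, h] at h1 h2
  exact h1.unique h2

lemma isomCLM_one : isomCLM 1 0 = ContinuousLinearMap.id ℂ EllTwoZ :=
  ellTwoZ_ext fun n => by simp [isomCLM, isom_basisVec]

lemma isomCLM_comp (k l : ℕ+) (i j : ℕ) :
    (isomCLM k i).comp (isomCLM l j) = isomCLM (k * l) (i + k * j) :=
  ellTwoZ_ext fun n => by
    simp only [isomCLM, ContinuousLinearMap.comp_apply, LinearIsometry.coe_toContinuousLinearMap,
      isom_basisVec]
    congr 1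
    push_cast
    ring

lemma frobK_one (x : EllTwoZ →L[ℂ] EllTwoZ) : frobK 1 x = x := by
  rw [frobK, PNat.one_coe, Finset.sum_range_one, isomCLM_one, ContinuousLinearMap.adjoint_id]
  rfl

lemma sum_range_mul_split {M : Type*} [AddCommMonoid M] (k l : ℕ) (g : ℕ → M) :
    ∑ n ∈ Finset.range (k * l), g n =
      ∑ i ∈ Finset.range k, ∑ j ∈ Finset.range l, g (i + k * j) := by
  rw [mul_comm, Finset.sum_range, ← finProdFinEquiv.sum_comp, Fintype.sum_prod_type,
    Finset.sum_comm, Finset.sum_range]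
  refine Finset.sum_congr rfl fun i _ => ?_
  rw [Finset.sum_range]
  rfl

lemma conj_comp_aux {H : Type*} [NormedAddCommGroup H] [InnerProductSpace ℂ H] [CompleteSpace H]
    (a b x : H →L[ℂ] H) :
    (a.comp b).comp (x.comp (ContinuousLinearMap.adjoint (a.comp b))) =
      a.comp ((b.comp (x.comp (ContinuousLinearMap.adjoint b))).comp
        (ContinuousLinearMap.adjoint a)) := by
  rw [ContinuousLinearMap.adjoint_comp]
  rfl

lemma frobK_mul_aux (k l : ℕ+) (i j : ℕ) (x : EllTwoZ →L[ℂ] EllTwoZ) :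
    (isomCLM (k * l) (i + k * j)).comp
        (x.comp (ContinuousLinearMap.adjoint (isomCLM (k * l) (i + k * j)))) =
      (isomCLM k i).comp (((isomCLM l j).comp (x.comp
        (ContinuousLinearMap.adjoint (isomCLM l j)))).comp
          (ContinuousLinearMap.adjoint (isomCLM k i))) := by
  rw [← isomCLM_comp]
  exact conj_comp_aux _ _ _

lemma sum_comp_aux (s : Finset ℕ) (a b : EllTwoZ →L[ℂ] EllTwoZ)
    (f : ℕ → EllTwoZ →L[ℂ] EllTwoZ) :
    a.comp ((∑ j ∈ s, f j).comp b) = ∑ j ∈ s, a.comp ((f j).comp b) := by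
  rw [ContinuousLinearMap.finsetSum_comp, ContinuousLinearMap.comp_finsetSum]

lemma frobK_mul (k l : ℕ+) (x : EllTwoZ →L[ℂ] EllTwoZ) :
    frobK (k * l) x = frobK k (frobK l x) := by
  unfold frobK
  rw [PNat.mul_coe, sum_range_mul_split]
  refine Finset.sum_congr rfl fun i _ => ?_
  rw [sum_comp_aux]
  exact Finset.sum_congr rfl fun j _ => frobK_mul_aux k l i j x

lemma frobK_mul' (k l : ℕ+) (x : EllTwoZ →L[ℂ] EllTwoZ) :
    frobK (l * k) x = frobK k (frobK l x) := by
  rw [mul_comm, frobK_mul]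

section Presheaf

open CategoryTheory

/-- `𝒦` as an object of the topos: the set of compact operators on `ℓ²(ℤ)`, on which
`k ∈ ℕ^×` acts by `Fr_k`. -/
noncomputable def compactPresheaf : (SingleObj ℕ+)ᵒᵖ ⥤ Type where
  obj _ := CompactOps
  map k := TypeCat.ofHom fun x => ⟨frobK k.unop x, frobK_mem _ x⟩
  map_id _ := by
    exact congrArg TypeCat.ofHom (funext fun x => Subtype.ext (frobK_one x))
  map_comp k l := by
    exact congrArg TypeCat.ofHom (funext fun x => Subtype.ext (frobK_mul' l.unop k.unop x))

end Presheaf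

section OperatorAlgebra

open CategoryTheory

/-- The operator underlying a section of the object `𝒦` of the topos. -/
noncomputable def opOf {c : (SingleObj ℕ+)ᵒᵖ} (x : compactPresheaf.obj c) :
    EllTwoZ →L[ℂ] EllTwoZ :=
  Subtype.val (p := fun T => T ∈ CompactOps) x

/-- The operations of an internal involutive algebra structure on the object `𝒦` of the topos are
the usual ones on compact operators: sum, scalar multiple, composition and adjoint. (The zero and
the negatives are then the usual ones too.) -/
structure IsOperatorAlgebraObj (S : InvolutiveAlgebraObj compactPresheaf) : Prop where
  add : ∀ {c} (x y : compactPresheaf.obj c), opOf (S.add.app c (x, y)) = opOf x + opOf y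
  smul : ∀ {c} (z : ℂ) (x : compactPresheaf.obj c), opOf ((S.smul z).app c x) = z • opOf x
  mul : ∀ {c} (x y : compactPresheaf.obj c),
    opOf (S.mul.app c (x, y)) = (opOf x).comp (opOf y)
  star : ∀ {c} (x : compactPresheaf.obj c),
    opOf (S.star.app c x) = ContinuousLinearMap.adjoint (opOf x)

end OperatorAlgebra

/-! ### Pre-C*-algebras, matroid C*-algebras -/

section PreCStar

variable {A : Type v} [NonUnitalRing A] [StarRing A] [Module ℂ A] [IsScalarTower ℂ A A]
  [SMulCommClass ℂ A A]

/-- `φ` exhibits the C*-algebra `B` as the completion of the involutive algebra `A` for the norm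
`‖x‖ = sup {|z|^{1/2} | z ∈ ℂ, x^* x - z is not invertible in A ⊕ ℂ}`, where `A ⊕ ℂ` is obtained
by adjoining a unit to `A`. (That this formula defines a norm on `A` follows from the existence
of such a `φ`.) -/
structure IsCStarCompletion {B : Type w} [NonUnitalCStarAlgebra B] (φ : A →⋆ₙₐ[ℂ] B) : Prop where
  injective : Function.Injective φ
  denseRange : DenseRange φ
  isLUB_norm : ∀ x : A,
    IsLUB ((fun z : ℂ => √‖z‖) '' spectrum ℂ ((star x * x : A) : Unitization ℂ A)) ‖φ x‖

variable (A)

/-- The involutive algebra `A` is a pre-C*-algebra: the formula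
`‖x‖ = sup {|z|^{1/2} | z ∈ ℂ, x^* x - z is not invertible in A ⊕ ℂ}` defines a norm on `A`, and
the completion of `A` for this norm is a C*-algebra. -/
def IsPreCStarAlgebra : Prop :=
  ∃ (B : Type v) (_ : NonUnitalCStarAlgebra B) (φ : A →⋆ₙₐ[ℂ] B), IsCStarCompletion φ

/-- The C*-algebra `B` is isomorphic to the completion of the pre-C*-algebra `A`. -/
def IsCompletedBy (B : Type w) [NonUnitalCStarAlgebra B] : Prop :=
  ∃ φ : A →⋆ₙₐ[ℂ] B, IsCStarCompletion φ

end PreCStar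

section Matroid

variable (A : Type v) [NonUnitalCStarAlgebra A]

/-- A matroid C*-algebra: an inductive limit of full matrix algebras `M_n(ℂ)`, `n ≥ 1`, where no
compatibility with units is required; in other words, a C*-algebra with a directed family of
*-subalgebras, each isomorphic to some `M_n(ℂ)`, whose union is dense. -/
def IsMatroid : Prop :=
  ∃ 𝓜 : Set (NonUnitalStarSubalgebra ℂ A), DirectedOn (· ≤ ·) 𝓜 ∧
    (∀ M ∈ 𝓜, ∃ n : ℕ, 0 < n ∧ Nonempty (M ≃⋆ₐ[ℂ] Matrix (Fin n) (Fin n) ℂ)) ∧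
    Dense {a : A | ∃ M ∈ 𝓜, a ∈ M}

open scoped ComplexOrder in
/-- Every non-zero trace of `A` is unbounded: `A` has no non-zero bounded trace, i.e. no non-zero
bounded positive linear functional `τ` with `τ(ab) = τ(ba)`. (A matroid C*-algebra has a non-zero
lower semicontinuous, densely defined trace, unique up to scaling; the algebra is called infinite
when this trace is unbounded, finite when it is bounded.) -/
def HasNoBoundedTrace : Prop :=
  ∀ τ : A →L[ℂ] ℂ, (∀ a, 0 ≤ τ (star a * a)) → (∀ a b, τ (a * b) = τ (b * a)) → τ = 0

/-- Infinite separable matroid C*-algebras. -/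
structure IsInfiniteSeparableMatroid : Prop where
  matroid : IsMatroid A
  separable : TopologicalSpace.SeparableSpace A
  infinite : HasNoBoundedTrace A

end Matroid

/-!
A flat action of `ℕ^×` on `X` is a directed system whose arrows are the relations `x = F(k) z`, and
the stalk at the corresponding point is the colimit of copies of `𝒦` along the maps `Fr_k`. Each
`Fr_k` is an injective *-homomorphism, so the stalk carries the spectral norm of its copies of
`𝒦`, and since finite matrices are dense in `𝒦` the completion is separable matroid. A bounded
trace vanishes on it because `𝒦` contains infinitely many orthogonal equivalent projections.

The point is recovered from the completion `A` as the set of equivalence classes of those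
projections which are images of rank-one projections of the copies of `𝒦`: every compact projection
is equivalent to `Fr_n` of a rank-one projection, with `n` its rank, so a *-isomorphism of
completions induces an equivariant bijection. Conversely, the normalized trace on the matrix
algebras of an infinite matroid `A` takes rational values, which generate a flat `ℕ^×`-set; since
the trace is unbounded there is room to exhaust `A` by finite corners of `𝒦`, compatibly with the
`Fr_k`.
-/

section CompactOperators

open Filter Topology

variable {𝕜 E F G ι : Type*} [RCLike 𝕜] [NormedAddCommGroup E] [NormedAddCommGroup F]

lemma tendsto_comp_zero_of_isCompactOperator [NormedSpace 𝕜 E] [NormedSpace 𝕜 F]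
    [NormedAddCommGroup G] [NormedSpace 𝕜 G] {l : Filter ι} {Q : ι → F →L[𝕜] G} {C : ℝ}
    (hQ : ∀ i, ‖Q i‖ ≤ C) (hlim : ∀ v, Tendsto (fun i => Q i v) l (𝓝 0))
    {T : E →L[𝕜] F} (hT : IsCompactOperator T) :
    Tendsto (fun i => (Q i).comp T) l (𝓝 0) := by
  rcases isEmpty_or_nonempty ι with h | ⟨⟨i₀⟩⟩
  · rw [l.filter_eq_bot_of_isEmpty]
    exact tendsto_bot
  have hC : 0 ≤ C := (norm_nonneg _).trans (hQ i₀)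
  have hcompact := IsCompactOperator.isCompact_closure_image_closedBall
    (f := (T : E →ₗ[𝕜] F)) hT 1
  rw [Metric.tendsto_nhds]
  intro ε hε
  set δ := ε / (2 * (C + 1)) with hδ
  have hδ0 : 0 < δ := by positivity
  obtain ⟨t, htf, ht⟩ := Metric.totallyBounded_iff.1 hcompact.totallyBounded δ hδ0
  have hsmall : ∀ᶠ i in l, ∀ y ∈ t, ‖Q i y‖ < δ :=
    htf.eventually_all.2 fun y _ => by
      simpa using (hlim y).eventually (Metric.ball_mem_nhds _ hδ0)
  filter_upwards [hsmall] with i hi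
  rw [dist_zero_right]
  have hbound : ‖(Q i).comp T‖ ≤ (C + 1) * δ := by
    refine ContinuousLinearMap.opNorm_le_of_unit_norm (by positivity) fun v hv => ?_
    obtain ⟨y, hy, hd⟩ : ∃ y ∈ t, ‖T v - y‖ < δ := by
      simpa [dist_eq_norm] using ht (subset_closure ⟨v, by simp [hv], rfl⟩)
    calc ‖Q i (T v)‖ = ‖Q i (T v - y) + Q i y‖ := by rw [map_sub, sub_add_cancel]
      _ ≤ C * ‖T v - y‖ + ‖Q i y‖ :=
          norm_add_le_of_le ((Q i).le_of_opNorm_le (hQ i) _) le_rfl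
      _ ≤ C * δ + δ := by gcongr; exact (hi y hy).le
      _ = (C + 1) * δ := by ring
  have : (C + 1) * δ = ε / 2 := by rw [hδ]; field_simp
  linarith

lemma tendsto_comp_of_isCompactOperator [NormedSpace 𝕜 E] [NormedSpace 𝕜 F] {l : Filter ι}
    {P : ι → F →L[𝕜] F} (hP : ∀ i, ‖P i‖ ≤ 1) (hlim : ∀ v, Tendsto (fun i => P i v) l (𝓝 v))
    {T : E →L[𝕜] F} (hT : IsCompactOperator T) :
    Tendsto (fun i => (P i).comp T) l (𝓝 T) := by
  have hnorm (i : ι) : ‖P i - .id 𝕜 F‖ ≤ 2 := by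
    linarith [norm_sub_le (P i) (.id 𝕜 F), hP i, ContinuousLinearMap.norm_id_le (𝕜 := 𝕜) (E := F)]
  have h := tendsto_comp_zero_of_isCompactOperator hnorm
    (fun v => by simpa using (hlim v).sub_const v) hT
  simpa using h.add_const T

lemma isCompactOperator_adjoint [InnerProductSpace 𝕜 E] [InnerProductSpace 𝕜 F] [CompleteSpace E]
    [CompleteSpace F] {T : E →L[𝕜] F} (hT : IsCompactOperator T) :
    IsCompactOperator (ContinuousLinearMap.adjoint T) := by
  classical
  let P (s : Finset F) : F →L[𝕜] F := (Submodule.span 𝕜 (s : Set F)).starProjection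
  have hP : Tendsto (fun s => (P s).comp T) atTop (𝓝 T) := by
    refine tendsto_comp_of_isCompactOperator (fun s => Submodule.starProjection_norm_le _)
      (fun v => tendsto_const_nhds.congr' ?_) hT
    filter_upwards [eventually_ge_atTop {v}] with s hs
    exact (Submodule.starProjection_eq_self_iff.2 (Submodule.subset_span (by simpa using hs))).symm
  refine isCompactOperator_of_tendsto
    (((ContinuousLinearMap.adjoint (𝕜 := 𝕜) (E := E) (F := F)).continuous.tendsto T).comp hP)
    (Eventually.of_forall fun s => ?_)
  have hfinite : IsCompactOperator (P s) :=
    (isCompactOperator_of_locallyCompactSpace_dom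
      (Submodule.span 𝕜 (s : Set F)).orthogonalProjectionOnto).clm_comp (Submodule.subtypeL _)
  rw [Function.comp_apply, ContinuousLinearMap.adjoint_comp,
    (isSelfAdjoint_starProjection (Submodule.span 𝕜 (s : Set F))).adjoint_eq]
  exact hfinite.clm_comp (ContinuousLinearMap.adjoint T)

end CompactOperators

section KAlg

/-- The C*-algebra `𝒦` of compact operators on `ℓ²(ℤ)`. -/
noncomputable def KAlg : NonUnitalStarSubalgebra ℂ (EllTwoZ →L[ℂ] EllTwoZ) where
  carrier := {T | IsCompactOperator T}
  add_mem' {a b} ha hb := IsCompactOperator.add (f := a) (g := b) ha hb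
  zero_mem' := isCompactOperator_zero
  mul_mem' {a b} ha _ := IsCompactOperator.comp_clm (f := a) ha b
  smul_mem' c T hT := IsCompactOperator.smul (f := T) hT c
  star_mem' hT := isCompactOperator_adjoint hT

instance : IsClosed (KAlg : Set (EllTwoZ →L[ℂ] EllTwoZ)) := isClosed_setOfPred_isCompactOperator

noncomputable instance : NonUnitalCStarAlgebra KAlg := inferInstance

lemma inner_basisVec (p q : ℤ) : inner ℂ (basisVec p) (basisVec q) = if p = q then (1 : ℂ) else 0 :=
  orthonormal_iff_ite.1 orthonormal_basisVec p q

lemma ellTwoZ_ext_inner {v w : EllTwoZ}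
    (h : ∀ n, inner ℂ (basisVec n) v = inner ℂ (basisVec n) w) : v = w := by
  ext n
  simpa [basisVec, lp.inner_single_left] using h n

/-- The matrix entry `⟨δ_p, x δ_q⟩` of a compact operator `x`. -/
noncomputable def entry (p q : ℤ) : KAlg →ₗ[ℂ] ℂ where
  toFun x := inner ℂ (basisVec p) ((x : EllTwoZ →L[ℂ] EllTwoZ) (basisVec q))
  map_add' _ _ := inner_add_right _ _ _
  map_smul' _ _ := inner_smul_right _ _ _

lemma entry_apply (p q : ℤ) (x : KAlg) :
    entry p q x = inner ℂ (basisVec p) ((x : EllTwoZ →L[ℂ] EllTwoZ) (basisVec q)) := rfl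

lemma ext_entry {x y : KAlg} (h : ∀ p q, entry p q x = entry p q y) : x = y :=
  Subtype.ext (ellTwoZ_ext fun q => ellTwoZ_ext_inner fun p => h p q)

/-- The matrix unit `|δ_p⟩⟨δ_q|` as a compact operator. -/
noncomputable def matUnit (p q : ℤ) : KAlg :=
  ⟨InnerProductSpace.rankOne ℂ (basisVec p) (basisVec q),
    (isCompactOperator_of_locallyCompactSpace_rng
      (ContinuousLinearMap.toSpanSingleton ℂ (basisVec p))).comp_clm (innerSL ℂ (basisVec q))⟩

lemma matUnit_apply (p q : ℤ) (v : EllTwoZ) :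
    (matUnit p q : EllTwoZ →L[ℂ] EllTwoZ) v = inner ℂ (basisVec q) v • basisVec p := rfl

lemma entry_matUnit (p q r s : ℤ) :
    entry p q (matUnit r s) = if p = r ∧ s = q then 1 else 0 := by
  simp only [entry_apply, matUnit_apply, inner_smul_right, inner_basisVec, mul_ite, mul_one,
    mul_zero, ite_and]

lemma matUnit_mul (p q r s : ℤ) :
    matUnit p q * matUnit r s = if q = r then matUnit p s else 0 := by
  refine Subtype.ext (ContinuousLinearMap.ext fun v => ?_)
  have h : ((matUnit p q * matUnit r s : KAlg) : EllTwoZ →L[ℂ] EllTwoZ) v =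
      inner ℂ (basisVec s) v • inner ℂ (basisVec q) (basisVec r) • basisVec p :=
    ((matUnit p q : EllTwoZ →L[ℂ] EllTwoZ).map_smul _ _).trans rfl
  rw [h, inner_basisVec]
  split_ifs
  · rw [one_smul, matUnit_apply]
  · simp

lemma star_matUnit (p q : ℤ) : star (matUnit p q) = matUnit q p :=
  Subtype.ext (InnerProductSpace.adjoint_rankOne _ _)

lemma matUnit_ne_zero (p q : ℤ) : matUnit p q ≠ 0 := fun h => by
  simpa [entry_matUnit] using congrArg (entry p q) h

lemma isStarProjection_matUnit (p : ℤ) : IsStarProjection (matUnit p p) :=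
  ⟨by simp [IsIdempotentElem, matUnit_mul], star_matUnit p p⟩

end KAlg

section Frob

lemma emod_eq_and_ediv_eq_iff {k : ℕ+} {j : ℕ} (hj : j < k) {a n : ℤ} :
    (a % k = j ∧ a / k = n) ↔ k * n + j = a := by
  have hk : (0 : ℤ) < k := by exact_mod_cast k.pos
  rw [and_comm, Int.ediv_emod_unique hk, add_comm]
  exact and_iff_left ⟨by positivity, by exact_mod_cast hj⟩

lemma star_isomCLM_basisVec {k : ℕ+} {j : ℕ} (hj : j < k) (a : ℤ) :
    star (isomCLM k j) (basisVec a) = if a % k = j then basisVec (a / k) else 0 := by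
  refine ellTwoZ_ext_inner fun n => ?_
  rw [ContinuousLinearMap.star_eq_adjoint, ContinuousLinearMap.adjoint_inner_right, isomCLM,
    LinearIsometry.coe_toContinuousLinearMap, isom_basisVec, inner_basisVec]
  simp only [← emod_eq_and_ediv_eq_iff hj]
  by_cases hmod : a % k = j
  · simp [hmod, inner_basisVec, eq_comm]
  · simp [hmod]

lemma star_isomCLM_mul {k : ℕ+} {i j : ℕ} (hi : i < k) (hj : j < k) :
    star (isomCLM k i) * isomCLM k j = if i = j then 1 else 0 := by
  refine ellTwoZ_ext fun n => ?_
  obtain ⟨hmod, hdiv⟩ := (emod_eq_and_ediv_eq_iff hj).2 (rfl : (k * n + j : ℤ) = _)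
  have h : isomCLM k j (basisVec n) = basisVec (k * n + j) := isom_basisVec k j n
  rw [mul_apply_eq_comp, h, star_isomCLM_basisVec hi, hmod, hdiv]
  by_cases hij : i = j
  · simp [hij]
  · simp [hij, Ne.symm hij]

lemma frobK_eq_sum (k : ℕ+) (x : EllTwoZ →L[ℂ] EllTwoZ) :
    frobK k x = ∑ j ∈ Finset.range k, isomCLM k j * x * star (isomCLM k j) := rfl

lemma frobK_map_mul (k : ℕ+) (x y : EllTwoZ →L[ℂ] EllTwoZ) :
    frobK k (x * y) = frobK k x * frobK k y := by
  simp only [frobK_eq_sum, Finset.sum_mul_sum]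
  refine Finset.sum_congr rfl fun i hi => ?_
  have hterm (j : ℕ) (hj : j ∈ Finset.range k) :
      isomCLM k i * x * star (isomCLM k i) * (isomCLM k j * y * star (isomCLM k j)) =
        isomCLM k i * x * (if i = j then 1 else 0) * y * star (isomCLM k j) := by
    rw [← star_isomCLM_mul (Finset.mem_range.1 hi) (Finset.mem_range.1 hj)]
    noncomm_ring
  rw [Finset.sum_congr rfl hterm, Finset.sum_eq_single_of_mem i hi]
  · simp [mul_assoc]
  · intro j _ hji
    simp [hji.symm]

lemma frobK_map_star (k : ℕ+) (x : EllTwoZ →L[ℂ] EllTwoZ) :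
    frobK k (star x) = star (frobK k x) := by
  simp [frobK_eq_sum, star_sum, star_mul, mul_assoc]

/-- The endomorphism `Fr_k` of the C*-algebra of compact operators. -/
noncomputable def frob (k : ℕ+) : KAlg →⋆ₙₐ[ℂ] KAlg where
  toFun x := ⟨frobK k x, frobK_mem k x⟩
  map_smul' c x := Subtype.ext (by simp [frobK_eq_sum, Finset.smul_sum])
  map_zero' := Subtype.ext (by simp [frobK_eq_sum])
  map_add' x y := Subtype.ext (by simp [frobK_eq_sum, mul_add, add_mul, Finset.sum_add_distrib])
  map_mul' x y := Subtype.ext (frobK_map_mul k x y)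
  map_star' x := Subtype.ext (frobK_map_star k x)

lemma entry_frob (k : ℕ+) (x : KAlg) (a b : ℤ) :
    entry a b (frob k x) = if a % k = b % k then entry (a / k) (b / k) x else 0 := by
  have hk : (0 : ℤ) < k := by exact_mod_cast k.pos
  obtain ⟨r, hr⟩ := Int.eq_ofNat_of_zero_le (Int.emod_nonneg b hk.ne')
  have hrk : r < k := by exact_mod_cast hr ▸ Int.emod_lt_of_pos b hk
  have hterm (j : ℕ) (hj : j ∈ Finset.range k) :
      inner ℂ (basisVec a) ((isomCLM k j * x.1 * star (isomCLM k j)) (basisVec b)) =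
        if r = j then (if a % k = b % k then entry (a / k) (b / k) x else 0) else 0 := by
    rw [Finset.mem_range] at hj
    rw [mul_apply_eq_comp, mul_apply_eq_comp, star_isomCLM_basisVec hj, hr,
      ← ContinuousLinearMap.adjoint_inner_left, ← ContinuousLinearMap.star_eq_adjoint,
      star_isomCLM_basisVec hj]
    by_cases hjr : r = j
    · subst hjr
      simp only [if_true, entry_apply]
      split_ifs <;> simp
    · simp [hjr]
  calc entry a b (frob k x)
      = ∑ j ∈ Finset.range k,
          inner ℂ (basisVec a) ((isomCLM k j * x.1 * star (isomCLM k j)) (basisVec b)) := by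
        rw [← inner_sum, ← sum_apply]; rfl
    _ = _ := by rw [Finset.sum_congr rfl hterm, Finset.sum_ite_eq, if_pos (Finset.mem_range.2 hrk)]

lemma frob_injective (k : ℕ+) : Function.Injective (frob k) := by
  intro x y h
  refine ext_entry fun p q => ?_
  have hk : (k : ℤ) ≠ 0 := by exact_mod_cast k.ne_zero
  simpa [entry_frob, hk] using congrArg (entry (k * p) (k * q)) h

lemma frob_matUnit (k : ℕ+) (p q : ℤ) :
    frob k (matUnit p q) = ∑ j ∈ Finset.range k, matUnit (k * p + j) (k * q + j) := by
  have hsum (j : ℕ) : isomCLM k j * (matUnit p q : EllTwoZ →L[ℂ] EllTwoZ) * star (isomCLM k j) =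
      matUnit (k * p + j) (k * q + j) := by
    change isomCLM k j ∘L (InnerProductSpace.rankOne ℂ (basisVec p) (basisVec q) ∘L
      ContinuousLinearMap.adjoint (isomCLM k j)) = _
    rw [InnerProductSpace.rankOne_comp, InnerProductSpace.comp_rankOne,
      ContinuousLinearMap.adjoint_adjoint]
    simp [isomCLM, isom_basisVec, matUnit]
  apply Subtype.ext
  rw [AddSubmonoidClass.coe_finsetSum]
  exact Finset.sum_congr (s₁ := Finset.range k) rfl fun j _ => hsum j

end Frob

section Corner

open Filter Topology

/-- The square matrices indexed by a finite set `F` of integers, as operators on `ℓ²(ℤ)` vanishing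
on `δ_n` for `n ∉ F`. -/
noncomputable def corner (F : Finset ℤ) : Matrix F F ℂ →⋆ₙₐ[ℂ] KAlg where
  toFun T := ∑ p : F, ∑ q : F, T p q • matUnit p q
  map_smul' c T := by simp [mul_smul, Finset.smul_sum]
  map_zero' := by simp
  map_add' S T := by simp [add_smul, Finset.sum_add_distrib]
  map_mul' S T := by
    simp only [Finset.sum_mul]
    refine Finset.sum_congr rfl fun p _ => ?_
    simp only [Finset.mul_sum, Matrix.mul_apply, Finset.sum_smul]
    rw [Finset.sum_comm]
    refine Finset.sum_congr rfl fun r _ => Eq.symm ?_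
    rw [Finset.sum_eq_single_of_mem r (Finset.mem_univ r)]
    · simp [smul_mul_smul_comm, matUnit_mul]
    · intro s _ hs
      simp [smul_mul_smul_comm, matUnit_mul, hs.symm]
  map_star' T := by
    simp only [star_sum, star_smul, star_matUnit, Matrix.star_apply]
    exact Finset.sum_comm

lemma corner_apply (F : Finset ℤ) (T : Matrix F F ℂ) :
    corner F T = ∑ p : F, ∑ q : F, T p q • matUnit p q := rfl

lemma entry_corner {F : Finset ℤ} (T : Matrix F F ℂ) {p q : ℤ} (hp : p ∈ F) (hq : q ∈ F) :
    entry p q (corner F T) = T ⟨p, hp⟩ ⟨q, hq⟩ := by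
  simp only [corner_apply, map_sum, map_smul, entry_matUnit, smul_eq_mul]
  rw [Finset.sum_eq_single_of_mem ⟨p, hp⟩ (Finset.mem_univ _),
    Finset.sum_eq_single_of_mem ⟨q, hq⟩ (Finset.mem_univ _)]
  · simp
  · intro r _ hr
    simp [show (r : ℤ) ≠ q from fun h => hr (Subtype.ext h)]
  · intro r _ hr
    simp [show p ≠ r from fun h => hr (Subtype.ext h.symm)]

lemma entry_corner_of_notMem {F : Finset ℤ} (T : Matrix F F ℂ) {p q : ℤ}
    (h : ¬(p ∈ F ∧ q ∈ F)) : entry p q (corner F T) = 0 := by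
  simp only [corner_apply, map_sum, map_smul, entry_matUnit, smul_eq_mul]
  refine Finset.sum_eq_zero fun r _ => Finset.sum_eq_zero fun s _ => ?_
  rw [if_neg, mul_zero]
  rintro ⟨rfl, rfl⟩
  exact h ⟨r.2, s.2⟩

lemma corner_injective (F : Finset ℤ) : Function.Injective (corner F) := fun S T h =>
  Matrix.ext fun p q => by
    simpa only [entry_corner _ p.2 q.2] using congrArg (entry p q) h

/-- The matrix of the entries of `x` with both indices in `F`. -/
noncomputable def truncate (F : Finset ℤ) (x : KAlg) : Matrix F F ℂ :=
  Matrix.of fun p q => entry p q x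

lemma corner_truncate {F : Finset ℤ} {x : KAlg}
    (hx : ∀ p q, ¬(p ∈ F ∧ q ∈ F) → entry p q x = 0) : corner F (truncate F x) = x := by
  refine ext_entry fun p q => ?_
  by_cases h : p ∈ F ∧ q ∈ F
  · exact entry_corner _ h.1 h.2
  · rw [entry_corner_of_notMem _ h, hx p q h]

/-- The finite set of the integers `p` with `⌊p / k⌋ ∈ F`, on which `Fr_k` dilates the operators
supported by `F`. -/
noncomputable def dilateSet (k : ℕ+) (F : Finset ℤ) : Finset ℤ :=
  F.biUnion fun q => Finset.Ico (k * q) (k * q + k)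

lemma mem_dilateSet {k : ℕ+} {F : Finset ℤ} {p : ℤ} : p ∈ dilateSet k F ↔ p / k ∈ F := by
  have hk : (0 : ℤ) < k := by exact_mod_cast k.pos
  simp only [dilateSet, Finset.mem_biUnion, Finset.mem_Ico]
  constructor
  · rintro ⟨q, hq, h₁, h₂⟩
    rwa [show p / (k : ℤ) = q from
      (Int.ediv_emod_unique (r := p - k * q) hk).2 ⟨by ring, by linarith, by linarith⟩ |>.1]
  · intro h
    have := Int.mul_ediv_add_emod p k
    exact ⟨_, h, by linarith [Int.emod_nonneg p hk.ne'], by linarith [Int.emod_lt_of_pos p hk]⟩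

lemma card_dilateSet_le (k : ℕ+) (F : Finset ℤ) : (dilateSet k F).card ≤ k * F.card := by
  rw [mul_comm]
  exact Finset.card_biUnion_le_card_mul _ _ _ fun q _ => by simp

/-- The amplification of a matrix by `k`: the matrix of `Fr_k (corner F T)` on the indices in
`J`. -/
noncomputable def dilate (k : ℕ+) {F : Finset ℤ} (J : Finset ℤ) (T : Matrix F F ℂ) : Matrix J J ℂ :=
  truncate J (frob k (corner F T))

lemma corner_dilate (k : ℕ+) {F J : Finset ℤ} (hJ : dilateSet k F ⊆ J)
    (T : Matrix F F ℂ) : corner J (dilate k J T) = frob k (corner F T) := by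
  refine corner_truncate fun p q h => ?_
  rw [entry_frob]
  split_ifs
  · exact entry_corner_of_notMem _ fun h' =>
      h ⟨hJ (mem_dilateSet.2 h'.1), hJ (mem_dilateSet.2 h'.2)⟩
  · rfl

lemma corner_one (F : Finset ℤ) : corner F 1 = ∑ p ∈ F, matUnit p p := by
  rw [corner_apply, ← Finset.sum_coe_sort F]
  exact Finset.sum_congr rfl fun p _ => by simp [Matrix.one_apply]

lemma isStarProjection_corner_one (F : Finset ℤ) : IsStarProjection (corner F 1) :=
  (IsStarProjection.one (R := Matrix F F ℂ)).map (corner F)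

lemma tendsto_corner_one_apply (v : EllTwoZ) :
    Tendsto (fun F => (corner F 1 : EllTwoZ →L[ℂ] EllTwoZ) v) atTop (𝓝 v) := by
  have hv := lp.hasSum_single (E := fun _ : ℤ => ℂ) (p := 2) (by norm_num) v
  refine hv.congr fun F => ?_
  simp only [corner_one, AddSubmonoidClass.coe_finsetSum, sum_apply, matUnit_apply]
  refine Finset.sum_congr rfl fun p _ => ?_
  rw [basisVec, ← lp.single_smul, lp.inner_single_left]
  simp

lemma tendsto_corner_one_mul (x : KAlg) :
    Tendsto (fun F => corner F 1 * x) atTop (𝓝 x) :=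
  tendsto_subtype_rng.2 <| tendsto_comp_of_isCompactOperator
    (fun F => ((isStarProjection_corner_one F).map
      (NonUnitalStarSubalgebraClass.subtype KAlg)).norm_le) tendsto_corner_one_apply x.2

lemma tendsto_corner_one_mul_mul (x : KAlg) :
    Tendsto (fun F => corner F 1 * x * corner F 1) atTop (𝓝 x) := by
  have hleft := tendsto_corner_one_mul x
  have hright : Tendsto (fun F => x * corner F 1) atTop (𝓝 x) := by
    simpa [(isStarProjection_corner_one _).isSelfAdjoint.star_eq] using
      (tendsto_corner_one_mul (star x)).star
  rw [tendsto_iff_norm_sub_tendsto_zero] at hleft hright ⊢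
  refine squeeze_zero (fun _ => norm_nonneg _) (fun F => ?_) (by simpa using hright.add hleft)
  calc ‖corner F 1 * x * corner F 1 - x‖
      = ‖corner F 1 * (x * corner F 1 - x) + (corner F 1 * x - x)‖ := by
        congr 1; noncomm_ring
    _ ≤ ‖x * corner F 1 - x‖ + ‖corner F 1 * x - x‖ := by
        refine (norm_add_le _ _).trans (add_le_add_left ((norm_mul_le _ _).trans ?_) _)
        exact mul_le_of_le_one_left (norm_nonneg _) (isStarProjection_corner_one F).norm_le

lemma corner_one_mul_mul_mem_range (F : Finset ℤ) (x : KAlg) :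
    corner F 1 * x * corner F 1 ∈ Set.range (corner F) := by
  have hunit (p q : ℤ) : matUnit p p * x * matUnit q q = entry p q x • matUnit p q := by
    refine Subtype.ext (ContinuousLinearMap.ext fun v => ?_)
    change inner ℂ (basisVec p) (x.1 (inner ℂ (basisVec q) v • basisVec q)) • basisVec p =
      entry p q x • inner ℂ (basisVec q) v • basisVec p
    rw [map_smul, inner_smul_right, mul_comm, mul_smul, entry_apply]
  refine ⟨truncate F x, ?_⟩
  simp only [corner_one, Finset.sum_mul, Finset.mul_sum, hunit]
  rw [Finset.sum_comm, corner_apply, ← Finset.sum_coe_sort F]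
  exact Finset.sum_congr rfl fun p _ => Finset.sum_coe_sort F fun q => entry p q x • matUnit p q

lemma eventually_exists_corner_near (x : KAlg) {ε : ℝ} (hε : 0 < ε) :
    ∀ᶠ F in atTop, ∃ T, ‖corner F T - x‖ < ε := by
  filter_upwards [(tendsto_corner_one_mul_mul x).eventually (Metric.ball_mem_nhds x hε)] with F hF
  obtain ⟨T, hT⟩ := corner_one_mul_mul_mem_range F x
  exact ⟨T, by rwa [hT, ← mem_ball_iff_norm]⟩

end Corner

section FrobSystems

open Filter Topology

/-- A set with a flat (filtering) action of `ℕ^×`. -/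
structure IsFlatAction (X : Type*) [MulAction ℕ+ X] : Prop where
  nonempty : Nonempty X
  exists_common : ∀ x y : X, ∃ (z : X) (k l : ℕ+), k • z = x ∧ l • z = y
  free : ∀ (x : X) (k l : ℕ+), k • x = l • x → k = l

namespace IsFlatAction

variable {X : Type*} [MulAction ℕ+ X]

lemma smul_injective (hX : IsFlatAction X) (k : ℕ+) : Function.Injective (k • · : X → X) := by
  intro x y h
  obtain ⟨z, a, b, rfl, rfl⟩ := hX.exists_common x y
  simp only [smul_smul] at h
  rw [mul_left_cancel (hX.free z _ _ h)]

lemma countable (hX : IsFlatAction X) : Countable X := by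
  obtain ⟨x₀⟩ := hX.nonempty
  have hcover : (Set.univ : Set X) = ⋃ k : ℕ+, ⋃ l : ℕ+, {x | ∃ z : X, k • z = x₀ ∧ l • z = x} := by
    refine (Set.eq_univ_of_forall fun x => ?_).symm
    obtain ⟨z, k, l, hx₀, hx⟩ := hX.exists_common x₀ x
    exact Set.mem_iUnion₂.2 ⟨k, l, z, hx₀, hx⟩
  rw [← Set.countable_univ_iff, hcover]
  refine Set.countable_iUnion fun k => Set.countable_iUnion fun l => Set.Subsingleton.countable ?_
  rintro _ ⟨z, hz, rfl⟩ _ ⟨z', hz', rfl⟩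
  rw [hX.smul_injective k (hz.trans hz'.symm)]

end IsFlatAction

lemma KAlg.hasNoBoundedTrace (τ : KAlg →L[ℂ] ℂ) (hτ : ∀ x y, τ (x * y) = τ (y * x)) : τ = 0 := by
  have hdiag (p : ℤ) : τ (matUnit p p) = τ (matUnit 0 0) := by
    simpa [matUnit_mul] using hτ (matUnit p 0) (matUnit 0 p)
  have hoff {p q : ℤ} (hpq : p ≠ q) : τ (matUnit p q) = 0 := by
    simpa [matUnit_mul, hpq.symm] using hτ (matUnit p p) (matUnit p q)
  -- The value of `τ` on a projection of rank `n` is `n τ(|δ_0⟩⟨δ_0|)`, bounded by `‖τ‖`.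
  have hzero : τ (matUnit 0 0) = 0 := by
    by_contra hne
    obtain ⟨n, hn⟩ := exists_nat_gt (‖τ‖ / ‖τ (matUnit 0 0)‖)
    rw [div_lt_iff₀ (norm_pos_iff.2 hne)] at hn
    have hvalue : τ (corner (Finset.Ico (0 : ℤ) n) 1) = n * τ (matUnit 0 0) := by
      rw [corner_one, map_sum, Finset.sum_congr rfl fun p _ => hdiag p]
      simp
    have hle : ‖τ (corner (Finset.Ico (0 : ℤ) n) 1)‖ ≤ ‖τ‖ :=
      τ.unit_le_opNorm _ (isStarProjection_corner_one _).norm_le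
    rw [hvalue, norm_mul, Complex.norm_natCast] at hle
    linarith
  have hunit (p q : ℤ) : τ (matUnit p q) = 0 := by
    rcases eq_or_ne p q with rfl | hpq
    · rw [hdiag, hzero]
    · exact hoff hpq
  ext x
  refine tendsto_nhds_unique ((τ.continuous.tendsto x).comp (tendsto_corner_one_mul_mul x))
    (tendsto_const_nhds.congr fun F => ?_)
  obtain ⟨T, hT⟩ := corner_one_mul_mul_mem_range F x
  rw [Function.comp_apply, ← hT, corner_apply]
  simp [hunit]

/-- A system of embeddings of the compact operators in a C*-algebra `B`, compatible with the
endomorphisms `Fr_k`, which exhibits `B` as an inductive limit over `X`. -/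
structure FrobSystem (X : Type*) [MulAction ℕ+ X] (B : Type*) [NonUnitalCStarAlgebra B] where
  hom : X → KAlg →⋆ₙₐ[ℂ] B
  injective : ∀ x, Function.Injective (hom x)
  hom_smul : ∀ (k : ℕ+) (x : X) (T : KAlg), hom (k • x) T = hom x (frob k T)
  dense : Dense {b | ∃ x T, hom x T = b}

namespace FrobSystem

variable {X : Type*} [MulAction ℕ+ X] {B : Type*} [NonUnitalCStarAlgebra B]

lemma norm_hom (Φ : FrobSystem X B) (x : X) (T : KAlg) : ‖Φ.hom x T‖ = ‖T‖ :=
  NonUnitalStarAlgHom.norm_map (Φ.hom x) (Φ.injective x) T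

/-- The full matrix algebra in `B` which is the image of a finite corner of the copy of `𝒦`
indexed by `x`. -/
noncomputable def block (Φ : FrobSystem X B) (x : X) (F : Finset ℤ) : Matrix F F ℂ →⋆ₙₐ[ℂ] B :=
  (Φ.hom x).comp (corner F)

lemma block_apply (Φ : FrobSystem X B) (x : X) (F : Finset ℤ) (T : Matrix F F ℂ) :
    Φ.block x F T = Φ.hom x (corner F T) := rfl

lemma block_injective (Φ : FrobSystem X B) (x : X) (F : Finset ℤ) :
    Function.Injective (Φ.block x F) :=
  (Φ.injective x).comp (corner_injective F)

lemma block_smul (Φ : FrobSystem X B) (k : ℕ+) (x : X) {F J : Finset ℤ} (hJ : dilateSet k F ⊆ J)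
    (T : Matrix F F ℂ) : Φ.block (k • x) F T = Φ.block x J (dilate k J T) := by
  rw [block_apply, Φ.hom_smul, ← corner_dilate k hJ, block_apply]

lemma exists_block_near (Φ : FrobSystem X B) (b : B) {ε : ℝ} (hε : 0 < ε) :
    ∃ x F, F.Nonempty ∧ ∃ T, dist b (Φ.block x F T) < ε := by
  obtain ⟨_, ⟨x, T, rfl⟩, hb⟩ := Metric.mem_closure_iff.1 (Φ.dense b) (ε / 2) (half_pos hε)
  obtain ⟨F, ⟨S, hS⟩, hF⟩ := ((eventually_exists_corner_near T (half_pos hε)).and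
    (eventually_ge_atTop {0})).exists
  refine ⟨x, F, (Finset.singleton_nonempty _).mono hF, S,
    (dist_triangle _ (Φ.hom x T) _).trans_lt ?_⟩
  rw [← Φ.norm_hom x, map_sub, ← dist_eq_norm, dist_comm, ← block_apply] at hS
  linarith

lemma isMatroid (Φ : FrobSystem X B) (hX : IsFlatAction X) : IsMatroid B := by
  refine ⟨{M | ∃ (x : X) (F : Finset ℤ), F.Nonempty ∧ M = NonUnitalStarAlgHom.range (Φ.block x F)},
    ?_, ?_, ?_⟩
  · rintro _ ⟨x, F, hF, rfl⟩ _ ⟨y, G, -, rfl⟩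
    obtain ⟨z, k, l, rfl, rfl⟩ := hX.exists_common x y
    have hne : (dilateSet k F ∪ dilateSet l G).Nonempty := by
      obtain ⟨p, hp⟩ := hF
      exact ⟨k * p, Finset.mem_union_left _ (mem_dilateSet.2 (by simpa using hp))⟩
    refine ⟨_, ⟨z, _, hne, rfl⟩, ?_, ?_⟩
    · rintro _ ⟨T, rfl⟩
      exact ⟨_, (Φ.block_smul k z Finset.subset_union_left T).symm⟩
    · rintro _ ⟨T, rfl⟩
      exact ⟨_, (Φ.block_smul l z Finset.subset_union_right T).symm⟩
  · rintro _ ⟨x, F, hF, rfl⟩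
    refine ⟨F.card, hF.card_pos, ⟨?_⟩⟩
    exact (StarAlgEquiv.ofInjective' (R := ℂ) _ (Φ.block_injective x F)).symm.trans
      (StarAlgEquiv.ofAlgEquiv (Matrix.reindexAlgEquiv ℂ ℂ F.equivFin) fun _ => rfl)
  · refine fun b => Metric.mem_closure_iff.2 fun ε hε => ?_
    obtain ⟨x, F, hF, T, hT⟩ := Φ.exists_block_near b hε
    exact ⟨_, ⟨_, ⟨x, F, hF, rfl⟩, T, rfl⟩, hT⟩

lemma separableSpace (Φ : FrobSystem X B) (hX : IsFlatAction X) :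
    TopologicalSpace.SeparableSpace B := by
  have := hX.countable
  have hseparable (x : X) (F : Finset ℤ) :
      TopologicalSpace.IsSeparable (Set.range (Φ.block x F)) := by
    have : TopologicalSpace.SeparableSpace (Matrix F F ℂ) :=
      inferInstanceAs (TopologicalSpace.SeparableSpace (F → F → ℂ))
    exact TopologicalSpace.isSeparable_range
      (LinearMap.continuous_of_finiteDimensional (Φ.block x F : Matrix F F ℂ →ₗ[ℂ] B))
  rw [← TopologicalSpace.isSeparable_univ_iff]
  refine (TopologicalSpace.IsSeparable.iUnion fun x =>
    TopologicalSpace.IsSeparable.iUnion (hseparable x)).closure.mono fun b _ => ?_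
  refine Metric.mem_closure_iff.2 fun ε hε => ?_
  obtain ⟨x, F, -, T, hT⟩ := Φ.exists_block_near b hε
  exact ⟨_, Set.mem_iUnion₂.2 ⟨x, F, T, rfl⟩, hT⟩

lemma hasNoBoundedTrace (Φ : FrobSystem X B) : HasNoBoundedTrace B := by
  intro τ _ hτ
  have hhom (x : X) (T : KAlg) : τ (Φ.hom x T) = 0 := by
    let σ : KAlg →L[ℂ] ℂ := (τ.toLinearMap.comp (Φ.hom x : KAlg →ₗ[ℂ] B)).mkContinuous ‖τ‖
      fun T => (τ.le_opNorm _).trans_eq (congrArg _ (Φ.norm_hom x T))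
    have hσ : σ = 0 := KAlg.hasNoBoundedTrace σ fun S T =>
      show τ (Φ.hom x (S * T)) = τ (Φ.hom x (T * S)) by
        rw [map_mul (Φ.hom x), map_mul (Φ.hom x), hτ]
    exact congrArg (· T) hσ
  refine ContinuousLinearMap.ext fun b => congrFun (f := τ) (g := fun _ => 0) ?_ b
  refine τ.continuous.ext_on Φ.dense continuous_const ?_
  rintro _ ⟨x, T, rfl⟩
  exact hhom x T

theorem isInfiniteSeparableMatroid (Φ : FrobSystem X B) (hX : IsFlatAction X) :
    IsInfiniteSeparableMatroid B :=
  ⟨Φ.isMatroid hX, Φ.separableSpace hX, Φ.hasNoBoundedTrace⟩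

end FrobSystem

end FrobSystems

section IdempotentEquivalence

/-- Algebraic equivalence of idempotents; both `e` and `f` are meant to be idempotent. -/
def IdemEquiv {R : Type*} [Mul R] (e f : R) : Prop :=
  ∃ a b : R, a * b = e ∧ b * a = f

namespace IdemEquiv

lemma symm {R : Type*} [Mul R] {e f : R} : IdemEquiv e f → IdemEquiv f e
  | ⟨a, b, he, hf⟩ => ⟨b, a, hf, he⟩

lemma trans {R : Type*} [Semigroup R] {e f g : R} (he : IsIdempotentElem e)
    (hg : IsIdempotentElem g) (h : IdemEquiv e f) (h' : IdemEquiv f g) : IdemEquiv e g := by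
  obtain ⟨a, b, rfl, rfl⟩ := h
  obtain ⟨c, d, hcd, rfl⟩ := h'
  refine ⟨a * c, d * b, ?_, ?_⟩
  · rw [mul_assoc, ← mul_assoc c, hcd, ← mul_assoc, ← mul_assoc, mul_assoc, he]
  · rw [mul_assoc, ← mul_assoc b, ← hcd, ← mul_assoc, ← mul_assoc, mul_assoc, hg]

lemma map {R S F : Type*} [Mul R] [Mul S] [FunLike F R S] [MulHomClass F R S] (φ : F)
    {e f : R} : IdemEquiv e f → IdemEquiv (φ e) (φ f)
  | ⟨a, b, he, hf⟩ => ⟨φ a, φ b, by rw [← map_mul, he], by rw [← map_mul, hf]⟩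

end IdemEquiv

lemma idemEquiv_of_norm_sub_lt_one_of_unital {A : Type*} [CStarAlgebra A] {e f : A}
    (he : IsIdempotentElem e) (hf : IsStarProjection f) (h : ‖e - f‖ < 1) : IdemEquiv e f := by
  have hff : f * f = f := hf.isIdempotentElem
  set z : A := f * e + (1 - f) * (1 - e) with hz
  have hone_sub : 1 - z = -((2 * f - 1) * (e - f)) := by
    calc 1 - z = f + e - 2 * (f * e) + 2 * (f * f - f) := by rw [hz, hff]; noncomm_ring
      _ = _ := by noncomm_ring
  have hunit : IsUnit z := by
    rw [← sub_sub_cancel 1 z]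
    refine isUnit_one_sub_of_norm_lt_one ?_
    rwa [hone_sub, norm_neg,
      CStarRing.norm_mem_unitary_mul _ hf.two_mul_sub_one_mem_unitary]
  have hcomm : z * e = f * z := by
    rw [hz]
    simp only [mul_add, add_mul, mul_sub, sub_mul, ← mul_assoc, hff, mul_assoc _ e e, he.eq]
    noncomm_ring
  obtain ⟨u, hu⟩ := hunit
  rw [← hu] at hcomm
  refine ⟨e * ↑u⁻¹, u * e, ?_, ?_⟩
  · rw [mul_assoc, u.inv_mul_cancel_left, he]
  · rw [← mul_assoc, mul_assoc (u : A), he, hcomm, u.mul_inv_cancel_right]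

lemma idemEquiv_of_norm_sub_lt_one {A : Type*} [NonUnitalCStarAlgebra A] {e f : A}
    (he : IsIdempotentElem e) (hf : IsStarProjection f) (h : ‖e - f‖ < 1) : IdemEquiv e f := by
  obtain ⟨a, b, hab, hba⟩ : IdemEquiv (e : Unitization ℂ A) f :=
    idemEquiv_of_norm_sub_lt_one_of_unital ((Unitization.isIdempotentElem_inr_iff ℂ).2 he)
      (Unitization.isStarProjection_inr_iff.2 hf)
      (by rwa [← Unitization.inr_sub, Unitization.norm_inr])
  -- `A` is an ideal of its unitization, so it contains `e a` and `b e`.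
  obtain ⟨c, hc⟩ : ∃ c : A, (c : Unitization ℂ A) = e * a :=
    ⟨(e * a : Unitization ℂ A).snd, Unitization.ext (by simp) (by simp)⟩
  obtain ⟨d, hd⟩ : ∃ d : A, (d : Unitization ℂ A) = b * e :=
    ⟨(b * e : Unitization ℂ A).snd, Unitization.ext (by simp) (by simp)⟩
  have he' : (e * e : Unitization ℂ A) = e := by rw [← Unitization.inr_mul, he]
  have hf' : (f * f : Unitization ℂ A) = f := by rw [← Unitization.inr_mul, hf.isIdempotentElem]
  refine ⟨c, d, Unitization.inr_injective (R := ℂ) ?_, Unitization.inr_injective (R := ℂ) ?_⟩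
  · rw [Unitization.inr_mul, hc, hd, mul_assoc, ← mul_assoc a, hab, he', he']
  · rw [Unitization.inr_mul, hd, hc, mul_assoc, ← mul_assoc (e : Unitization ℂ A), he', ← hab,
      mul_assoc, ← mul_assoc b, hba, hf']

lemma one_le_norm_of_isIdempotentElem {A : Type*} [NonUnitalNormedRing A] {e : A}
    (he : IsIdempotentElem e) (h0 : e ≠ 0) : 1 ≤ ‖e‖ :=
  (le_mul_iff_one_le_left (norm_pos_iff.2 h0)).1 (by simpa only [he.eq] using norm_mul_le e e)

/-- A continuous function which is `0` near `0` and `1` near `1`. -/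
noncomputable def cutoff (t : ℝ) : ℝ := max 0 (min 1 (4 * t - 3 / 2))

lemma continuous_cutoff : Continuous cutoff := by
  unfold cutoff
  fun_prop

lemma cutoff_mul_self_and_abs_sub_le {t : ℝ} (h : |t * t - t| ≤ 1 / 8) :
    cutoff t * cutoff t = cutoff t ∧ |cutoff t - t| ≤ 1 / 4 := by
  obtain ⟨hlower, hupper⟩ := abs_le.1 h
  rcases le_or_gt t (1 / 2) with ht | ht
  · have hle : t ≤ 1 / 4 := by nlinarith
    have hzero : cutoff t = 0 := max_eq_left ((min_le_right _ _).trans (by linarith))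
    rw [hzero, zero_sub, abs_neg]
    exact ⟨mul_zero 0, abs_le.2 ⟨by nlinarith, hle⟩⟩
  · have hge : 3 / 4 ≤ t := by nlinarith
    have hone : cutoff t = 1 := by
      rw [cutoff, min_eq_left (by linarith), max_eq_right zero_le_one]
    rw [hone]
    exact ⟨mul_one 1, abs_le.2 ⟨by nlinarith, by linarith⟩⟩

lemma exists_isStarProjection_near {A : Type*} [NonUnitalCStarAlgebra A] {a : A}
    (ha : IsSelfAdjoint a) (h : ‖a * a - a‖ ≤ 1 / 8) :
    ∃ f : A, IsStarProjection f ∧ ‖f - a‖ ≤ 1 / 4 := by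
  have hcont := continuous_cutoff
  have hzero : cutoff 0 = 0 := by norm_num [cutoff]
  have hspec (t : ℝ) (ht : t ∈ quasispectrum ℝ a) : |t * t - t| ≤ 1 / 8 := by
    refine (norm_apply_le_norm_cfcₙ (fun t : ℝ => t * t - t) a ht).trans ?_
    rwa [cfcₙ_sub .., cfcₙ_mul .., cfcₙ_id' ℝ a]
  refine ⟨cfcₙ cutoff a, ⟨?_, cfcₙ_predicate cutoff a⟩, ?_⟩
  · rw [IsIdempotentElem, ← cfcₙ_mul cutoff cutoff a]
    exact cfcₙ_congr fun t ht => (cutoff_mul_self_and_abs_sub_le (hspec t ht)).1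
  · have hsub : cfcₙ cutoff a - a = cfcₙ (fun t => cutoff t - t) a := by
      rw [cfcₙ_sub .., cfcₙ_id' ℝ a]
    rw [hsub]
    exact norm_cfcₙ_le fun t ht => (cutoff_mul_self_and_abs_sub_le (hspec t ht)).2

end IdempotentEquivalence

section FiniteRank

open Filter Topology

lemma finiteDimensional_range_of_isIdempotentElem {𝕜 E : Type*} [NontriviallyNormedField 𝕜]
    [CompleteSpace 𝕜] [NormedAddCommGroup E] [NormedSpace 𝕜 E] {g : E →L[𝕜] E}
    (hcompact : IsCompactOperator g) (hg : IsIdempotentElem g) :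
    FiniteDimensional 𝕜 (g : E →ₗ[𝕜] E).range := by
  have hfix (v : (g : E →ₗ[𝕜] E).range) : g v = v := by
    obtain ⟨_, w, rfl⟩ := v
    exact DFunLike.congr_fun hg w
  refine FiniteDimensional.of_isCompactOperator_id (𝕜 := 𝕜) ?_
  have hrestrict := IsCompactOperator.restrict (f := (g : E →ₗ[𝕜] E)) hcompact
    (fun v _ => LinearMap.mem_range_self _ v)
    (ContinuousLinearMap.IsIdempotentElem.isClosed_range hg)
  convert! hrestrict using 1
  exact funext fun v => Subtype.ext (hfix v).symm

/-- The inclusion of `ℂ^n` in `ℓ²(ℤ)` as the span of `δ_0, …, δ_{n - 1}`. -/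
noncomputable def finIncl (n : ℕ) : (Fin n → ℂ) →L[ℂ] EllTwoZ :=
  ∑ j : Fin n, (ContinuousLinearMap.proj j).smulRight (basisVec j)

/-- The coordinates at `0, …, n - 1` of a vector of `ℓ²(ℤ)`. -/
noncomputable def finCoord (n : ℕ) : EllTwoZ →L[ℂ] (Fin n → ℂ) :=
  ContinuousLinearMap.pi fun j => innerSL ℂ (basisVec j)

lemma finIncl_apply (n : ℕ) (c : Fin n → ℂ) : finIncl n c = ∑ j : Fin n, c j • basisVec j := by
  simp [finIncl, sum_apply]

lemma finCoord_finIncl (n : ℕ) (c : Fin n → ℂ) : finCoord n (finIncl n c) = c := by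
  ext i
  change inner ℂ (basisVec i) (finIncl n c) = c i
  simp [finIncl_apply, inner_basisVec, Fin.val_inj]

lemma frob_matUnit_zero_apply (n : ℕ+) (v : EllTwoZ) :
    (frob n (matUnit 0 0) : EllTwoZ →L[ℂ] EllTwoZ) v = finIncl n (finCoord n v) := by
  rw [finIncl_apply, frob_matUnit, AddSubmonoidClass.coe_finsetSum, sum_apply, Finset.sum_range]
  refine Finset.sum_congr rfl fun j _ => ?_
  simp only [mul_zero, zero_add]
  rfl

lemma exists_idemEquiv_frob {f : KAlg} (hf : IsIdempotentElem f) (h0 : f ≠ 0) :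
    ∃ n : ℕ+, IdemEquiv f (frob n (matUnit 0 0)) := by
  let g : EllTwoZ →L[ℂ] EllTwoZ := f
  let V : Submodule ℂ EllTwoZ := (g : EllTwoZ →ₗ[ℂ] EllTwoZ).range
  have hg : IsIdempotentElem g := congrArg Subtype.val hf
  have hfix (v : V) : g v = v := by
    obtain ⟨_, w, rfl⟩ := v
    exact DFunLike.congr_fun hg w
  have : FiniteDimensional ℂ V := finiteDimensional_range_of_isIdempotentElem f.2 hg
  have : Nontrivial V := by
    rw [Submodule.nontrivial_iff_ne_bot, Ne, LinearMap.range_eq_bot]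
    exact fun h => h0 (Subtype.ext (ContinuousLinearMap.coe_injective h))
  obtain ⟨n, hn⟩ : ∃ n : ℕ+, (n : ℕ) = Module.finrank ℂ V := ⟨⟨_, Module.finrank_pos⟩, rfl⟩
  let L : V ≃L[ℂ] (Fin n → ℂ) := ContinuousLinearEquiv.ofFinrankEq (by simp [hn])
  let a : EllTwoZ →L[ℂ] EllTwoZ := V.subtypeL ∘L (L.symm : (Fin n → ℂ) →L[ℂ] V) ∘L finCoord n
  let b : EllTwoZ →L[ℂ] EllTwoZ :=
    finIncl n ∘L (L : V →L[ℂ] (Fin n → ℂ)) ∘L g.codRestrict V (LinearMap.mem_range_self _)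
  have ha : IsCompactOperator a := by
    rw [show a = g * a from ContinuousLinearMap.ext fun v => (hfix _).symm]
    exact f.2.comp_clm a
  have hb : IsCompactOperator b := by
    have hpb : b = frob n (matUnit 0 0) * b := ContinuousLinearMap.ext fun v => by
      rw [mul_apply_eq_comp, frob_matUnit_zero_apply]
      exact congrArg (finIncl n) (finCoord_finIncl n _).symm
    rw [hpb]
    exact (frob n (matUnit 0 0)).2.comp_clm b
  refine ⟨n, ⟨a, ha⟩, ⟨b, hb⟩, Subtype.ext (ContinuousLinearMap.ext fun v => ?_),
    Subtype.ext (ContinuousLinearMap.ext fun v => ?_)⟩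
  · change (L.symm (finCoord n (finIncl n (L _))) : EllTwoZ) = g v
    rw [finCoord_finIncl, L.symm_apply_apply]
    rfl
  · rw [frob_matUnit_zero_apply]
    change finIncl n (L ⟨g (L.symm (finCoord n v)), _⟩) = _
    simp only [hfix, L.apply_symm_apply, Subtype.coe_eta]

-- `Fr_n (|δ_0⟩⟨δ_0|)` has rank `n`, so if `n < m` then some non-zero vector in the range of
-- `Fr_m (|δ_0⟩⟨δ_0|)` is killed by `Fr_n (|δ_0⟩⟨δ_0|) b`.
lemma one_le_norm_of_lt {m n : ℕ+} (h : n < m) (a b : KAlg) :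
    1 ≤ ‖frob m (matUnit 0 0) * a * frob n (matUnit 0 0) * b * frob m (matUnit 0 0) -
      frob m (matUnit 0 0)‖ := by
  let f : (Fin m → ℂ) →ₗ[ℂ] (Fin n → ℂ) := (finCoord n ∘L b.1 ∘L finIncl m).toLinearMap
  have hker : f.ker ≠ ⊥ := f.ker_ne_bot_of_finrank_lt (by simpa using h)
  obtain ⟨c, hc, hc0⟩ := (Submodule.ne_bot_iff _).1 hker
  have hkill : finCoord n (b.1 (finIncl m c)) = 0 := hc
  have hfix : (frob m (matUnit 0 0) : EllTwoZ →L[ℂ] EllTwoZ) (finIncl m c) = finIncl m c := by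
    rw [frob_matUnit_zero_apply, finCoord_finIncl]
  have hne : finIncl m c ≠ 0 := fun h0 => hc0 <| by
    rw [← finCoord_finIncl m c, h0, map_zero]
  set d : KAlg := frob m (matUnit 0 0) * a * frob n (matUnit 0 0) * b * frob m (matUnit 0 0) -
    frob m (matUnit 0 0)
  have hneg : d.1 (finIncl m c) = -finIncl m c := by
    change (frob m (matUnit 0 0)).1 (a.1 ((frob n (matUnit 0 0)).1 (b.1
      ((frob m (matUnit 0 0)).1 (finIncl m c))))) - (frob m (matUnit 0 0)).1 (finIncl m c) = _
    rw [hfix, frob_matUnit_zero_apply n, hkill]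
    simp
  have hle := d.1.le_opNorm (finIncl m c)
  rw [hneg, norm_neg] at hle
  exact (le_mul_iff_one_le_left (norm_pos_iff.2 hne)).1 hle

end FiniteRank

/-- The sum of `k` orthogonal copies of an element. -/
noncomputable def amplify {A : Type*} [NonUnitalCStarAlgebra A] (k : ℕ+) (φ ψ : KAlg →⋆ₙₐ[ℂ] A)
    (a : A) : A :=
  ∑ r ∈ Finset.range k, φ (matUnit r 0) * a * ψ (matUnit 0 r)

lemma amplify_mul_amplify {A : Type*} [NonUnitalCStarAlgebra A] (k : ℕ+)
    {φ ψ : KAlg →⋆ₙₐ[ℂ] A} {a b : A} (h : a * ψ (matUnit 0 0) * b = φ (matUnit 0 0)) :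
    amplify k φ ψ a * amplify k ψ φ b = φ (frob k (matUnit 0 0)) := by
  rw [frob_matUnit, map_sum, amplify, amplify, Finset.sum_mul_sum]
  refine Finset.sum_congr rfl fun r hr => ?_
  have hterm (s : ℕ) : φ (matUnit r 0) * a * ψ (matUnit 0 r) *
      (ψ (matUnit s 0) * b * φ (matUnit 0 s)) =
      φ (matUnit r 0) * (a * ψ (matUnit 0 r * matUnit s 0) * b) * φ (matUnit 0 s) := by
    rw [map_mul]
    simp only [mul_assoc]
  simp only [hterm, matUnit_mul]
  rw [Finset.sum_eq_single_of_mem r hr]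
  · rw [if_pos rfl, h, ← map_mul, ← map_mul]
    simp [matUnit_mul]
  · intro s _ hs
    simp [hs.symm]

namespace FrobSystem

variable {X : Type*} [MulAction ℕ+ X] {Y : Type*} [MulAction ℕ+ Y]
  {A : Type*} [NonUnitalCStarAlgebra A]

/-- The image in `A` of the rank-one projection `|δ_0⟩⟨δ_0|` of the copy of `𝒦` indexed by `x`. -/
noncomputable def rankOneProj (Φ : FrobSystem X A) (x : X) : A := Φ.hom x (matUnit 0 0)

lemma isStarProjection_rankOneProj (Φ : FrobSystem X A) (x : X) :
    IsStarProjection (Φ.rankOneProj x) :=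
  (isStarProjection_matUnit 0).map (Φ.hom x)

lemma rankOneProj_ne_zero (Φ : FrobSystem X A) (x : X) : Φ.rankOneProj x ≠ 0 :=
  (map_ne_zero_iff (Φ.hom x) (Φ.injective x)).2 (matUnit_ne_zero 0 0)

lemma rankOneProj_smul (Φ : FrobSystem X A) (k : ℕ+) (x : X) :
    Φ.rankOneProj (k • x) = Φ.hom x (frob k (matUnit 0 0)) :=
  Φ.hom_smul k x _

lemma not_idemEquiv_of_lt (Φ : FrobSystem X A) (hX : IsFlatAction X) (z : X) {k l : ℕ+}
    (hlk : l < k) : ¬ IdemEquiv (Φ.rankOneProj (k • z)) (Φ.rankOneProj (l • z)) := by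
  rintro ⟨a, b, hab, hba⟩
  set e := Φ.rankOneProj (k • z) with he
  set f := Φ.rankOneProj (l • z) with hf
  have hee : e * e = e := (Φ.isStarProjection_rankOneProj _).isIdempotentElem
  have hopen : IsOpen {p : A × A | ‖e * p.1 * f * p.2 * e - e‖ < 1} :=
    isOpen_lt (by fun_prop) continuous_const
  have hmem : (a, b) ∈ {p : A × A | ‖e * p.1 * f * p.2 * e - e‖ < 1} := by
    have hfix : e * a * f * b * e = e := by
      calc e * a * f * b * e = e * (a * b) * (a * b) * e := by
            simp only [← hba, mul_assoc]
        _ = e := by simp only [hab, hee]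
    simp [hfix]
  obtain ⟨⟨_, _⟩, hnear, ⟨x, S, rfl⟩, ⟨y, T, rfl⟩⟩ :=
    (Φ.dense.prod Φ.dense).inter_open_nonempty _ hopen ⟨_, hmem⟩
  obtain ⟨w₀, i, j, rfl, rfl⟩ := hX.exists_common x y
  obtain ⟨w, r, s, rfl, rfl⟩ := hX.exists_common z w₀
  rw [Set.mem_ofPred_eq, he, hf] at hnear
  simp only [smul_smul, Φ.hom_smul, rankOneProj_smul, ← map_mul, ← map_sub, Φ.norm_hom] at hnear
  exact absurd (one_le_norm_of_lt (mul_lt_mul_left hlk r) _ _) (not_le.2 hnear)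

lemma eq_of_idemEquiv (Φ : FrobSystem X A) (hX : IsFlatAction X) {x x' : X}
    (h : IdemEquiv (Φ.rankOneProj x) (Φ.rankOneProj x')) : x = x' := by
  obtain ⟨z, k, l, rfl, rfl⟩ := hX.exists_common x x'
  rcases lt_trichotomy k l with hkl | rfl | hkl
  · exact absurd h.symm (Φ.not_idemEquiv_of_lt hX z hkl)
  · rfl
  · exact absurd h (Φ.not_idemEquiv_of_lt hX z hkl)

lemma exists_hom_isStarProjection_near (Φ : FrobSystem X A) {e : A} (he : IsStarProjection e) :
    ∃ x f, IsStarProjection f ∧ ‖e - Φ.hom x f‖ < 1 := by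
  let U : Set A := {b | ‖star b * b * (star b * b) - star b * b‖ < 1 / 8} ∩
    {b | ‖star b * b - e‖ < 3 / 4}
  have hopen : IsOpen U :=
    (isOpen_lt (by fun_prop) continuous_const).inter (isOpen_lt (by fun_prop) continuous_const)
  have hmem : e ∈ U := by
    simp [U, he.isSelfAdjoint.star_eq, he.isIdempotentElem.eq]
  obtain ⟨_, ⟨hidem, hnear⟩, x, S, rfl⟩ := Φ.dense.inter_open_nonempty U hopen ⟨e, hmem⟩
  simp only [Set.mem_ofPred_eq, ← map_star, ← map_mul, ← map_sub, Φ.norm_hom] at hidem hnear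
  obtain ⟨f, hf, hfS⟩ :=
    exists_isStarProjection_near (IsSelfAdjoint.star_mul_self S) hidem.le
  refine ⟨x, f, hf, ?_⟩
  rw [← Φ.norm_hom x, map_sub] at hfS
  rw [norm_sub_rev]
  linarith [norm_sub_le_norm_sub_add_norm_sub (Φ.hom x f) (Φ.hom x (star S * S)) e]

lemma exists_idemEquiv (Φ : FrobSystem X A) {e : A} (he : IsStarProjection e) (h0 : e ≠ 0) :
    ∃ x, IdemEquiv e (Φ.rankOneProj x) := by
  obtain ⟨x, f, hf, hef⟩ := Φ.exists_hom_isStarProjection_near he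
  have hf0 : f ≠ 0 := by
    rintro rfl
    rw [map_zero, sub_zero] at hef
    exact absurd (one_le_norm_of_isIdempotentElem he.isIdempotentElem h0) (not_le.2 hef)
  obtain ⟨n, hn⟩ := exists_idemEquiv_frob hf.isIdempotentElem hf0
  refine ⟨n • x, ?_⟩
  have hequiv := hn.map (Φ.hom x)
  rw [← rankOneProj_smul] at hequiv
  exact (idemEquiv_of_norm_sub_lt_one he.isIdempotentElem (hf.map (Φ.hom x)) hef).trans
    he.isIdempotentElem (Φ.isStarProjection_rankOneProj _).isIdempotentElem hequiv

lemma idemEquiv_smul (Φ : FrobSystem X A) (Ψ : FrobSystem Y A) (k : ℕ+) {x : X} {y : Y}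
    (h : IdemEquiv (Φ.rankOneProj x) (Ψ.rankOneProj y)) :
    IdemEquiv (Φ.rankOneProj (k • x)) (Ψ.rankOneProj (k • y)) := by
  obtain ⟨a, b, hab, hba⟩ := h
  rw [Φ.rankOneProj_smul, Ψ.rankOneProj_smul]
  refine ⟨amplify k _ _ a, amplify k _ _ b, amplify_mul_amplify k ?_, amplify_mul_amplify k ?_⟩
  · change a * Ψ.rankOneProj y * b = Φ.rankOneProj x
    rw [← hba, ← mul_assoc, mul_assoc, hab, (Φ.isStarProjection_rankOneProj x).isIdempotentElem]
  · change b * Φ.rankOneProj x * a = Ψ.rankOneProj y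
    rw [← hab, ← mul_assoc, mul_assoc, hba, (Ψ.isStarProjection_rankOneProj y).isIdempotentElem]

theorem exists_equiv (Φ : FrobSystem X A) (Ψ : FrobSystem Y A) (hX : IsFlatAction X)
    (hY : IsFlatAction Y) : ∃ g : X ≃ Y, ∀ (k : ℕ+) (x : X), g (k • x) = k • g x := by
  choose g hg using fun x =>
    Ψ.exists_idemEquiv (Φ.isStarProjection_rankOneProj x) (Φ.rankOneProj_ne_zero x)
  choose h hh using fun y =>
    Φ.exists_idemEquiv (Ψ.isStarProjection_rankOneProj y) (Ψ.rankOneProj_ne_zero y)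
  have hΦ (x : X) := (Φ.isStarProjection_rankOneProj x).isIdempotentElem
  have hΨ (y : Y) := (Ψ.isStarProjection_rankOneProj y).isIdempotentElem
  refine ⟨⟨g, h, fun x => ?_, fun y => ?_⟩, fun k x => ?_⟩
  · exact (Φ.eq_of_idemEquiv hX ((hg x).trans (hΦ _) (hΦ _) (hh (g x)))).symm
  · exact (Ψ.eq_of_idemEquiv hY ((hh y).trans (hΨ _) (hΨ _) (hg (h y)))).symm
  · exact Ψ.eq_of_idemEquiv hY
      ((hg (k • x)).symm.trans (hΨ _) (hΨ _) (Φ.idemEquiv_smul Ψ k (hg x)))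

end FrobSystem

section MatrixRepresentations

open Matrix

lemma tracial_eq_mul_trace {R I : Type*} [CommRing R] [Fintype I] [DecidableEq I] (o : I)
    (τ : Matrix I I R →ₗ[R] R) (hτ : ∀ S T, τ (S * T) = τ (T * S)) (T : Matrix I I R) :
    τ T = τ (single o o 1) * T.trace := by
  have hdiag (i : I) : τ (single i i 1) = τ (single o o 1) := by
    simpa using hτ (single i o 1) (single o i 1)
  have hoff {i j : I} (hij : i ≠ j) : τ (single i j 1) = 0 := by
    simpa [hij.symm] using hτ (single i i 1) (single i j 1)
  suffices h : τ = τ (single o o 1) • traceLinearMap I R R from DFunLike.congr_fun h T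
  refine ext_linearMap R fun i j => LinearMap.ext_ring ?_
  rcases eq_or_ne i j with rfl | hij
  · simpa using hdiag i
  · simpa [hij] using hoff hij

variable {W : Type*} {I : Type*} [Fintype I] [DecidableEq I]

lemma isIdempotentElem_single (i : I) {R : Type*} [Semiring R] :
    IsIdempotentElem (single i i (1 : R)) := by
  simp [IsIdempotentElem]

lemma trace_eq_finrank_mul_trace {𝕜 : Type*} [Field 𝕜] [AddCommGroup W] [Module 𝕜 W]
    [FiniteDimensional 𝕜 W] (h : Matrix I I 𝕜 →ₙₐ[𝕜] Module.End 𝕜 W) (o : I) (T : Matrix I I 𝕜) :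
    LinearMap.trace 𝕜 W (h T) = Module.finrank 𝕜 (h (single o o 1)).range * T.trace := by
  rw [← (LinearMap.IsIdempotentElem.isProj_range _ ((isIdempotentElem_single o).map h)).trace]
  refine tracial_eq_mul_trace o (LinearMap.trace 𝕜 W ∘ₗ (h : Matrix I I 𝕜 →ₗ[𝕜] _))
    (fun S T => ?_) T
  change LinearMap.trace 𝕜 W (h (S * T)) = LinearMap.trace 𝕜 W (h (T * S))
  rw [map_mul h, map_mul h, LinearMap.trace_mul_comm]

variable [NormedAddCommGroup W] [InnerProductSpace ℂ W] [FiniteDimensional ℂ W]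

lemma inner_map_single (h : Matrix I I ℂ →⋆ₙₐ[ℂ] Module.End ℂ W) (i j : I) (v w : W) :
    inner ℂ (h (single i j 1) v) w = inner ℂ v (h (single j i 1) w) := by
  have hstar : star (single j i (1 : ℂ)) = single i j 1 := by
    rw [star_eq_conjTranspose, conjTranspose_single, star_one]
  rw [← hstar, map_star, LinearMap.star_eq_adjoint, LinearMap.adjoint_inner_left]

lemma exists_orthonormalBasis_extending {F : Finset ℤ}
    (h : Matrix F F ℂ →⋆ₙₐ[ℂ] Module.End ℂ W) (o : F) {k : ℕ+} {J : Finset ℤ}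
    {v : ZMod k → W} (hv : Orthonormal ℂ v) (hfix : ∀ r, h (single o o 1) (v r) = v r)
    (hJ : J.card = Module.finrank ℂ W) :
    ∃ b : OrthonormalBasis J ℂ W, ∀ (i : F) (p : J), (p : ℤ) / k = i →
      b p = h (single i o 1) (v (p : ℤ)) := by
  let u (p : J) : W :=
    if hp : (p : ℤ) / k ∈ F then h (single ⟨_, hp⟩ o 1) (v (p : ℤ)) else 0
  have hu (p : J) (hp : (p : ℤ) / k ∈ F) : u p = h (single ⟨_, hp⟩ o 1) (v (p : ℤ)) := dif_pos hp
  let s : Set J := {p | (p : ℤ) / k ∈ F}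
  have horth : Orthonormal ℂ (s.domRestrict u) := by
    rw [orthonormal_iff_ite]
    rintro ⟨p, hp⟩ ⟨q, hq⟩
    change inner ℂ (u p) (u q) = _
    rw [hu p hp, hu q hq, inner_map_single, ← Module.End.mul_apply, ← map_mul]
    by_cases hpq : (p : ℤ) / k = q / k
    · simp only [hpq, single_mul_single_same, mul_one, hfix, orthonormal_iff_ite.1 hv]
      refine if_congr ?_ rfl rfl
      rw [ZMod.intCast_eq_intCast_iff', Subtype.mk_eq_mk, Subtype.ext_iff]
      refine ⟨fun hmod => ?_, fun heq => by rw [heq]⟩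
      rw [← Int.mul_ediv_add_emod p k, ← Int.mul_ediv_add_emod q k, hpq, hmod]
    · rw [single_mul_single_of_ne _ _ _ _ (by simpa using hpq), map_zero, LinearMap.zero_apply,
        inner_zero_right, if_neg fun heq => hpq (by rw [Subtype.mk_eq_mk.1 heq])]
  obtain ⟨b, hb⟩ := horth.exists_orthonormalBasis_extension_of_card_eq (by simp [hJ])
  refine ⟨b, ?_⟩
  rintro ⟨_, hi⟩ p rfl
  exact (hb p hi).trans (hu p hi)

lemma map_single_orthonormalBasis {F : Finset ℤ}
    (h : Matrix F F ℂ →⋆ₙₐ[ℂ] Module.End ℂ W) (o : F) {k : ℕ+} {J : Finset ℤ}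
    (hJ : dilateSet k F ⊆ J) {v : ZMod k → W} (hfix : ∀ r, h (single o o 1) (v r) = v r)
    (htotal : ∀ w, h (single o o 1) w = w → (∀ r, inner ℂ (v r) w = 0) → w = 0)
    {b : OrthonormalBasis J ℂ W}
    (hb : ∀ (i : F) (p : J), (p : ℤ) / k = i → b p = h (single i o 1) (v (p : ℤ)))
    (j : F) (q : J) :
    h (single o j 1) (b q) = if (q : ℤ) / k = j then v (q : ℤ) else 0 := by
  have hk : (0 : ℤ) < k := by exact_mod_cast k.pos
  split_ifs with hq
  · rw [hb j q hq, ← Module.End.mul_apply, ← map_mul, single_mul_single_same, mul_one, hfix]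
  · refine htotal _ ?_ fun r => ?_
    · rw [← Module.End.mul_apply, ← map_mul, single_mul_single_same, mul_one]
    · have hr : ((r.val : ℤ)) < k := by exact_mod_cast r.val_lt
      have hdiv : (k * j + r.val : ℤ) / k = j := by
        rw [Int.mul_add_ediv_left _ _ hk.ne', Int.ediv_eq_zero_of_lt (by positivity) hr, add_zero]
      have hp : (k * j + r.val : ℤ) ∈ J := hJ (mem_dilateSet.2 (by rw [hdiv]; exact j.2))
      have hbp : b ⟨_, hp⟩ = h (single j o 1) (v r) := by
        simpa using hb j ⟨_, hp⟩ hdiv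
      rw [← inner_map_single, ← hbp, b.inner_eq_zero]
      exact fun heq => hq (heq ▸ hdiv)

lemma toMatrixOrthonormal_eq_dilate {F : Finset ℤ}
    (h : Matrix F F ℂ →⋆ₙₐ[ℂ] Module.End ℂ W) (o : F) {k : ℕ+} {J : Finset ℤ} {v : ZMod k → W}
    (hv : Orthonormal ℂ v) {b : OrthonormalBasis J ℂ W}
    (hb : ∀ (j : F) (q : J), h (single o j 1) (b q) = if (q : ℤ) / k = j then v (q : ℤ) else 0)
    (T : Matrix F F ℂ) : LinearMap.toMatrixOrthonormal b (h T) = dilate k J T := by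
  ext p q
  let φ : Matrix F F ℂ →⋆ₙₐ[ℂ] Matrix J J ℂ :=
    (LinearMap.toMatrixOrthonormal b : Module.End ℂ W →⋆ₙₐ[ℂ] Matrix J J ℂ).comp h
  suffices heq : entryLinearMap ℂ ℂ p q ∘ₗ (φ : Matrix F F ℂ →ₗ[ℂ] Matrix J J ℂ) =
      entry p q ∘ₗ ((frob k).comp (corner F) : Matrix F F ℂ →ₗ[ℂ] KAlg) from
    DFunLike.congr_fun heq T
  refine ext_linearMap ℂ fun i j => LinearMap.ext_ring ?_
  change LinearMap.toMatrixOrthonormal b (h (single i j 1)) p q =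
    entry p q (frob k (corner F (single i j 1)))
  have hsingle : single i j (1 : ℂ) = single i o 1 * single o j 1 := by simp
  have hcorner : corner F (single i j 1) = matUnit i j := by
    simp only [corner_apply, single_apply, ite_smul, one_smul, zero_smul, ite_and,
      Finset.sum_ite_irrel, Finset.sum_const_zero, Finset.sum_ite_eq, Finset.mem_univ, if_true]
  rw [hcorner, entry_frob, entry_matUnit, LinearMap.toMatrixOrthonormal_apply_apply, hsingle,
    map_mul, Module.End.mul_apply, ← inner_map_single, hb, hb]
  by_cases hp : (p : ℤ) / k = i
  · by_cases hq : (q : ℤ) / k = j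
    · simp [hp, hq, orthonormal_iff_ite.1 hv, ZMod.intCast_eq_intCast_iff']
    · simp [hq, Ne.symm hq]
  · simp [hp]

lemma trace_toMatrixOrthonormal (b : OrthonormalBasis I ℂ W) (f : Module.End ℂ W) :
    (LinearMap.toMatrixOrthonormal b f).trace = LinearMap.trace ℂ W f :=
  (LinearMap.trace_eq_matrix_trace ℂ b.toBasis f).symm

lemma exists_orthonormalBasis_dilate {F : Finset ℤ} (hF : F.Nonempty)
    (h : Matrix F F ℂ →⋆ₙₐ[ℂ] Module.End ℂ W) (hinj : Function.Injective h) :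
    ∃ k : ℕ+, (∀ T, LinearMap.trace ℂ W (h T) = k * T.trace) ∧
      ∀ J : Finset ℤ, J.card = Module.finrank ℂ W → dilateSet k F ⊆ J →
        ∃ b : OrthonormalBasis J ℂ W, ∀ T,
          LinearMap.toMatrixOrthonormal b (h T) = dilate k J T := by
  let o : F := ⟨hF.choose, hF.choose_spec⟩
  set V := (h (single o o 1)).range
  have hfix (w : W) : h (single o o 1) w = w ↔ w ∈ V :=
    (LinearMap.IsIdempotentElem.mem_range_iff ((isIdempotentElem_single o).map h)).symm
  have hpos : 0 < Module.finrank ℂ V := by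
    rw [Nat.pos_iff_ne_zero, Ne, Submodule.finrank_eq_zero, LinearMap.range_eq_bot,
      map_eq_zero_iff h hinj]
    exact fun hzero => one_ne_zero (α := ℂ) (by simpa using congrFun₂ hzero o o)
  let k : ℕ+ := ⟨_, hpos⟩
  have htrace (T : Matrix F F ℂ) : LinearMap.trace ℂ W (h T) = k * T.trace :=
    trace_eq_finrank_mul_trace (h : Matrix F F ℂ →ₙₐ[ℂ] Module.End ℂ W) o T
  refine ⟨k, htrace, fun J hJ hFJ => ?_⟩
  let c : OrthonormalBasis (ZMod k) ℂ V := (stdOrthonormalBasis ℂ V).reindex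
    (Fintype.equivOfCardEq (by rw [Fintype.card_fin, ZMod.card]; rfl))
  have hc : Orthonormal ℂ (fun r => (c r : W)) := c.orthonormal.comp_linearIsometry V.subtypeₗᵢ
  have hcfix (r : ZMod k) : h (single o o 1) (c r : W) = c r := (hfix _).2 (c r).2
  obtain ⟨b, hb⟩ := exists_orthonormalBasis_extending h o hc hcfix hJ
  refine ⟨b, toMatrixOrthonormal_eq_dilate h o hc
    (map_single_orthonormalBasis h o hFJ hcfix (fun w hw horth => ?_) hb)⟩
  have hw0 : (⟨w, (hfix w).1 hw⟩ : V) = 0 :=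
    InnerProductSpace.ext_inner_left_basis c.toBasis fun r => by simpa using horth r
  exact congrArg Subtype.val hw0

lemma exists_starAlgEquiv_dilate {F : Finset ℤ} (hF : F.Nonempty) {n : ℕ}
    (h : Matrix F F ℂ →⋆ₙₐ[ℂ] Matrix (Fin n) (Fin n) ℂ) (hinj : Function.Injective h) :
    ∃ k : ℕ+, (∀ T, (h T).trace = k * T.trace) ∧
      ∀ J : Finset ℤ, J.card = n → dilateSet k F ⊆ J →
        ∃ u : Matrix (Fin n) (Fin n) ℂ ≃⋆ₐ[ℂ] Matrix J J ℂ,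
          (∀ T, (u T).trace = T.trace) ∧ ∀ T, u (h T) = dilate k J T := by
  let m := LinearMap.toMatrixOrthonormal (EuclideanSpace.basisFun (Fin n) ℂ)
  have hm (T : Matrix (Fin n) (Fin n) ℂ) : LinearMap.trace ℂ _ (m.symm T) = T.trace := by
    rw [← trace_toMatrixOrthonormal (EuclideanSpace.basisFun (Fin n) ℂ), m.apply_symm_apply]
  let g : Matrix (Fin n) (Fin n) ℂ →⋆ₙₐ[ℂ] Module.End ℂ (EuclideanSpace ℂ (Fin n)) := m.symm
  obtain ⟨k, htrace, hbasis⟩ :=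
    exists_orthonormalBasis_dilate hF (g.comp h) (m.symm.injective.comp hinj)
  refine ⟨k, fun T => (hm _).symm.trans (htrace T), fun J hJ hFJ => ?_⟩
  obtain ⟨b, hb⟩ := hbasis J (by rw [hJ, finrank_euclideanSpace_fin]) hFJ
  refine ⟨m.symm.trans (LinearMap.toMatrixOrthonormal b), fun T => ?_, hb⟩
  exact (trace_toMatrixOrthonormal b _).trans (hm T)

open scoped Matrix.Norms.L2Operator in
lemma norm_trace_le {I : Type*} [Fintype I] [DecidableEq I] (T : Matrix I I ℂ) :
    ‖T.trace‖ ≤ Fintype.card I * ‖T‖ := by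
  have hdiag (i : I) : ‖T i i‖ ≤ ‖T‖ := by
    have hentry : T i i = inner ℂ (EuclideanSpace.basisFun I ℂ i)
        (toEuclideanCLM (n := I) (𝕜 := ℂ) T (EuclideanSpace.basisFun I ℂ i)) := by
      simp [EuclideanSpace.inner_single_left]
    have hnorm := (EuclideanSpace.basisFun I ℂ).norm_eq_one i
    rw [hentry]
    refine (norm_inner_le_norm _ _).trans ?_
    rw [hnorm, one_mul]
    exact ContinuousLinearMap.unit_le_opNorm _ _ hnorm.le
  calc ‖T.trace‖ ≤ ∑ i, ‖T i i‖ := norm_sum_le _ _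
    _ ≤ ∑ _i : I, ‖T‖ := Finset.sum_le_sum fun i _ => hdiag i
    _ = Fintype.card I * ‖T‖ := by simp

end MatrixRepresentations

section Closure

variable {A B : Type*} [NonUnitalCStarAlgebra A] [NonUnitalCStarAlgebra B]

lemma bijective_of_norm_eq_of_denseRange {E F Φ : Type*} [NormedAddCommGroup E] [CompleteSpace E]
    [NormedAddCommGroup F] [FunLike Φ E F] [AddMonoidHomClass Φ E F] (f : Φ)
    (hf : ∀ x, ‖f x‖ = ‖x‖) (hdense : DenseRange f) : Function.Bijective f := by
  have hiso := AddMonoidHomClass.isometry_of_norm f hf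
  refine ⟨hiso.injective, Set.range_eq_univ.1 ?_⟩
  rw [← hiso.isClosedEmbedding.isClosed_range.closure_eq, hdense.closure_range]

/-- The closure of the correspondence is the graph of the isomorphism. -/
lemma nonempty_starAlgEquiv_of_correspondence (R : NonUnitalStarSubalgebra ℂ (A × B))
    (hR : ∀ p ∈ R, ‖p.1‖ = ‖p.2‖) (hfst : Dense (Prod.fst '' (R : Set (A × B))))
    (hsnd : Dense (Prod.snd '' (R : Set (A × B)))) : Nonempty (A ≃⋆ₐ[ℂ] B) := by
  let Q := R.topologicalClosure
  have hQ (p : Q) : ‖p.1.1‖ = ‖p.1.2‖ :=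
    (isClosed_eq (by fun_prop) (by fun_prop) : IsClosed {p : A × B | ‖p.1‖ = ‖p.2‖})
      |>.closure_subset_iff.2 hR p.2
  have : CompleteSpace Q := R.isClosed_topologicalClosure.completeSpace_coe
  let f : Q →⋆ₙₐ[ℂ] A :=
    (NonUnitalStarAlgHom.fst ℂ A B).comp (NonUnitalStarSubalgebraClass.subtype Q)
  let g : Q →⋆ₙₐ[ℂ] B :=
    (NonUnitalStarAlgHom.snd ℂ A B).comp (NonUnitalStarSubalgebraClass.subtype Q)
  have hf : Function.Bijective f := by
    refine bijective_of_norm_eq_of_denseRange f (fun p => ?_) (hfst.mono ?_)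
    · exact ((congrArg (max _) (hQ p).symm).trans (max_self _)).symm
    · rintro _ ⟨p, hp, rfl⟩
      exact ⟨⟨p, R.le_topologicalClosure hp⟩, rfl⟩
  have hg : Function.Bijective g := by
    refine bijective_of_norm_eq_of_denseRange g (fun p => ?_) (hsnd.mono ?_)
    · exact ((congrArg (max · _) (hQ p)).trans (max_self _)).symm
    · rintro _ ⟨p, hp, rfl⟩
      exact ⟨⟨p, R.le_topologicalClosure hp⟩, rfl⟩
  exact ⟨(StarAlgEquiv.ofBijective f hf).symm.trans (StarAlgEquiv.ofBijective g hg)⟩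

end Closure

section MatroidTraces

open Matrix Filter Topology
open scoped ComplexOrder

variable {A : Type*} [NonUnitalCStarAlgebra A]

lemma exists_trace_of_directed {ι : Type*} [Preorder ι] [IsDirectedOrder ι] [Nonempty ι]
    {S : ι → NonUnitalStarSubalgebra ℂ A} (hS : Monotone S)
    (hdense : Dense (⋃ i, (S i : Set A))) {τ : ι → A →L[ℂ] ℂ} {C : ℝ} (hC : ∀ i, ‖τ i‖ ≤ C)
    (hpos : ∀ i, ∀ a ∈ S i, 0 ≤ τ i (star a * a))
    (htrace : ∀ i, ∀ a ∈ S i, ∀ b ∈ S i, τ i (a * b) = τ i (b * a)) :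
    ∃ t : A →L[ℂ] ℂ, (∀ a, 0 ≤ t (star a * a)) ∧ (∀ a b, t (a * b) = t (b * a)) ∧
      ∀ a z, (∀ i, τ i a = z) → t a = z := by
  let 𝒰 := Ultrafilter.of (atTop : Filter ι)
  obtain ⟨t, -, ht⟩ := (WeakDual.isCompact_closedBall (0 : StrongDual ℂ A) C).ultrafilter_le_nhds
    (𝒰.map fun i => StrongDual.toWeakDual (τ i)) (le_principal_iff.2 <| mem_map.2 <|
      univ_mem' fun i => mem_closedBall_zero_iff.2 (hC i))
  have hlim (a : A) : Tendsto (fun i => τ i a) 𝒰 (𝓝 (WeakDual.toStrongDual t a)) :=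
    ((WeakDual.eval_continuous a).tendsto t).comp ht
  have hmem {a : A} (ha : a ∈ ⋃ i, (S i : Set A)) : ∀ᶠ i in (𝒰 : Filter ι), a ∈ S i := by
    obtain ⟨j, hj⟩ := Set.mem_iUnion.1 ha
    exact (eventually_ge_atTop j).filter_mono (Ultrafilter.of_le _) |>.mono fun i hi => hS hi hj
  refine ⟨WeakDual.toStrongDual t, fun a => ?_, fun a b => ?_, fun a z h => ?_⟩
  · have hclosed : IsClosed {x : A | 0 ≤ WeakDual.toStrongDual t (star x * x)} :=
      isClosed_le continuous_const (by fun_prop)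
    refine hclosed.closure_subset_iff.2 (fun x hx => ?_) (hdense a)
    exact ge_of_tendsto (hlim _) ((hmem hx).mono fun i hi => hpos i x hi)
  · have hclosed : IsClosed {p : A × A |
        WeakDual.toStrongDual t (p.1 * p.2) = WeakDual.toStrongDual t (p.2 * p.1)} :=
      isClosed_eq (by fun_prop) (by fun_prop)
    refine hclosed.closure_subset_iff.2 (fun p hp => ?_) ((hdense.prod hdense) (a, b))
    refine tendsto_nhds_unique (hlim _) ((hlim _).congr' ?_)
    filter_upwards [hmem hp.1, hmem hp.2] with i h₁ h₂
    exact (htrace i _ h₁ _ h₂).symm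
  · exact tendsto_nhds_unique (hlim a) (tendsto_const_nhds.congr fun i => (h i).symm)

open scoped Matrix.Norms.L2Operator in
lemma exists_normalized_trace {N : NonUnitalStarSubalgebra ℂ A} {n : ℕ}
    (β : N ≃⋆ₐ[ℂ] Matrix (Fin n) (Fin n) ℂ) {e : N} (he : IsStarProjection e) (he0 : e ≠ 0) {C : ℝ}
    (hC : n ≤ C * ‖(β e).trace‖) :
    ∃ τ : A →L[ℂ] ℂ, ‖τ‖ ≤ C ∧ τ e = 1 ∧ (∀ a ∈ N, 0 ≤ τ (star a * a)) ∧
      ∀ a ∈ N, ∀ b ∈ N, τ (a * b) = τ (b * a) := by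
  have hpos : 0 < (β e).trace := by
    have hβe : β e = (β e)ᴴ * β e := by
      rw [← star_eq_conjTranspose, ← map_star, ← map_mul, he.isSelfAdjoint.star_eq,
        he.isIdempotentElem.eq]
    refine lt_of_le_of_ne (hβe ▸ (posSemidef_conjTranspose_mul_self _).trace_nonneg) fun h => he0 ?_
    rw [hβe, eq_comm, trace_conjTranspose_mul_self_eq_zero_iff] at h
    exact β.injective (h.trans (map_zero β).symm)
  have hnorm (x : N) : ‖β x‖ = ‖x‖ := by
    let γ : Matrix (Fin n) (Fin n) ℂ →⋆ₙₐ[ℂ] A := (NonUnitalStarSubalgebraClass.subtype N).comp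
      (β.symm : Matrix (Fin n) (Fin n) ℂ →⋆ₙₐ[ℂ] N)
    have hγ : Function.Injective γ := Subtype.val_injective.comp β.symm.injective
    simpa [γ] using (NonUnitalStarAlgHom.norm_map γ hγ (β x)).symm
  let p : Submodule ℂ A := N.toNonUnitalSubalgebra.toSubmodule
  let t : p →ₗ[ℂ] ℂ := (β e).trace⁻¹ • traceLinearMap (Fin n) ℂ ℂ ∘ₗ
    ((β : N →⋆ₙₐ[ℂ] Matrix (Fin n) (Fin n) ℂ) : N →ₗ[ℂ] Matrix (Fin n) (Fin n) ℂ)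
  have ht (x : p) : ‖t x‖ ≤ C * ‖x‖ := by
    calc ‖t x‖ = ‖(β e).trace‖⁻¹ * ‖(β x).trace‖ := by rw [← norm_inv, ← norm_mul]; rfl
      _ ≤ ‖(β e).trace‖⁻¹ * (n * ‖β x‖) := by
        gcongr; simpa using norm_trace_le (β x)
      _ ≤ C * ‖x‖ := by
        rw [hnorm, ← mul_assoc, inv_mul_eq_div]
        exact mul_le_mul_of_nonneg_right ((div_le_iff₀ (norm_pos_iff.2 hpos.ne')).2 hC)
          (norm_nonneg x)
  have hC0 : 0 ≤ C := nonneg_of_mul_nonneg_left (n.cast_nonneg.trans hC) (norm_pos_iff.2 hpos.ne')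
  obtain ⟨τ, hτ, hτnorm⟩ := exists_extension_norm_eq p (t.mkContinuous C ht)
  have hτN (x : N) : τ x = (β e).trace⁻¹ * (β x).trace := hτ x
  refine ⟨τ, hτnorm.trans_le (LinearMap.mkContinuous_norm_le _ hC0 _), ?_, fun a ha => ?_,
    fun a ha b hb => ?_⟩
  · rw [hτN, inv_mul_cancel₀ hpos.ne']
  · rw [show star a * a = ↑(star (⟨a, ha⟩ : N) * ⟨a, ha⟩) from rfl, hτN, map_mul, map_star]
    exact mul_nonneg (RCLike.inv_pos.2 hpos).le (posSemidef_conjTranspose_mul_self _).trace_nonneg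
  · have h₁ := hτN (⟨a, ha⟩ * ⟨b, hb⟩)
    have h₂ := hτN (⟨b, hb⟩ * ⟨a, ha⟩)
    rw [map_mul, trace_mul_comm, ← map_mul] at h₁
    exact h₁.trans h₂.symm

/-- A witness that `A` is a matroid C*-algebra. -/
structure IsMatrixFamily (𝓜 : Set (NonUnitalStarSubalgebra ℂ A)) : Prop where
  directed : DirectedOn (· ≤ ·) 𝓜
  exists_equiv : ∀ M ∈ 𝓜, ∃ n : ℕ, 0 < n ∧ Nonempty (M ≃⋆ₐ[ℂ] Matrix (Fin n) (Fin n) ℂ)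
  dense : Dense {a : A | ∃ M ∈ 𝓜, a ∈ M}

/-- Otherwise the traces normalized by their value at `e` would be uniformly bounded, and would
have a limit point. -/
lemma IsMatrixFamily.exists_mul_norm_trace_le {𝓜 : Set (NonUnitalStarSubalgebra ℂ A)}
    (h𝓜 : IsMatrixFamily 𝓜) (hA : HasNoBoundedTrace A) {M : NonUnitalStarSubalgebra ℂ A}
    (hM : M ∈ 𝓜) {e : M} (he : IsStarProjection e) (he0 : e ≠ 0) (C : ℝ) :
    ∃ N ∈ 𝓜, ∃ h : M ≤ N, ∃ (n : ℕ) (β : N ≃⋆ₐ[ℂ] Matrix (Fin n) (Fin n) ℂ),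
      C * ‖(β ⟨e, h e.2⟩).trace‖ ≤ n := by
  by_contra! hcon
  let ι := {N : NonUnitalStarSubalgebra ℂ A // N ∈ 𝓜 ∧ M ≤ N}
  have hτ (N : ι) : ∃ τ : A →L[ℂ] ℂ, ‖τ‖ ≤ C ∧ τ e = 1 ∧ (∀ a ∈ N.1, 0 ≤ τ (star a * a)) ∧
      ∀ a ∈ N.1, ∀ b ∈ N.1, τ (a * b) = τ (b * a) := by
    obtain ⟨n, -, ⟨β⟩⟩ := h𝓜.exists_equiv N N.2.1
    have he' : IsStarProjection (NonUnitalStarSubalgebra.inclusion N.2.2 e) := he.map _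
    exact exists_normalized_trace β he'
      (fun h => he0 (NonUnitalStarSubalgebra.inclusion_injective N.2.2 (h.trans (map_zero _).symm)))
      (hcon N N.2.1 N.2.2 n β).le
  choose τ hnorm hone hpos htrace using hτ
  have : Nonempty ι := ⟨⟨M, hM, le_rfl⟩⟩
  have : IsDirectedOrder ι := ⟨fun N N' => by
    obtain ⟨L, hL, h, h'⟩ := h𝓜.directed N N.2.1 N' N'.2.1
    exact ⟨⟨L, hL, N.2.2.trans h⟩, h, h'⟩⟩
  have hdense : Dense (⋃ N : ι, (N.1 : Set A)) := by
    refine h𝓜.dense.mono ?_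
    rintro x ⟨N, hN, hx⟩
    obtain ⟨L, hL, h, h'⟩ := h𝓜.directed N hN M hM
    exact Set.mem_iUnion.2 ⟨⟨L, hL, h'⟩, h hx⟩
  obtain ⟨t, htpos, httrace, ht⟩ :=
    exists_trace_of_directed (S := fun N : ι => N.1) (fun _ _ h => h) hdense hnorm hpos htrace
  simpa [hA t htpos httrace] using ht e 1 hone

end MatroidTraces

section MatrixTowers

open Matrix

/-- An increasing sequence of full matrix algebras with dense union, in matrix units for which the
inclusions are given by the endomorphisms `frob k`. The sets indexing the matrix units exhaust `ℤ`
even relative to `rank n`, which stands for the rank at stage `n` of a projection of the first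
stage. -/
structure MatrixTower (A : Type*) [NonUnitalCStarAlgebra A] where
  supp : ℕ → Finset ℤ
  embed (n : ℕ) : Matrix (supp n) (supp n) ℂ →⋆ₙₐ[ℂ] A
  injective_embed (n : ℕ) : Function.Injective (embed n)
  rank : ℕ → ℕ+
  ratio : ℕ → ℕ+
  rank_succ (n : ℕ) : rank (n + 1) = ratio n * rank n
  dilateSet_subset (n : ℕ) : dilateSet (ratio n) (supp n) ⊆ supp (n + 1)
  embed_dilate (n : ℕ) (T : Matrix (supp n) (supp n) ℂ) :
    embed (n + 1) (dilate (ratio n) (supp (n + 1)) T) = embed n T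
  Ico_subset (n : ℕ) :
    Finset.Ico (-(n * rank (n + 1)) : ℤ) (n * rank (n + 1)) ⊆ supp (n + 1)
  dense : Dense (⋃ n, Set.range (embed n))

variable {A : Type*} [NonUnitalCStarAlgebra A]

/-- A member of a family of full matrix algebras that contains a given projection `e`, with a
choice of matrix units indexed by a set of integers, and the rank of `e` in it. -/
structure MatrixStage (𝓜 : Set (NonUnitalStarSubalgebra ℂ A)) (e : A) where
  supp : Finset ℤ
  embed : Matrix supp supp ℂ →⋆ₙₐ[ℂ] A
  injective_embed : Function.Injective embed
  range_mem : NonUnitalStarAlgHom.range embed ∈ 𝓜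
  proj : Matrix supp supp ℂ
  embed_proj : embed proj = e
  rank : ℕ+
  trace_proj : proj.trace = rank

variable {𝓜 : Set (NonUnitalStarSubalgebra ℂ A)} {e : A}

lemma MatrixStage.supp_nonempty (σ : MatrixStage 𝓜 e) : σ.supp.Nonempty := by
  by_contra! h
  have : IsEmpty σ.supp := by rwa [Finset.isEmpty_coe_sort]
  have htrace : (σ.rank : ℂ) = 0 := by simp [← σ.trace_proj, trace]
  exact σ.rank.ne_zero (by exact_mod_cast htrace)

lemma exists_dilateSet_subset_Ico_subset {F : Finset ℤ} {k r : ℕ+} (hkr : k ≤ r) {i n : ℕ}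
    (hn : (F.card + 2 * i) * r ≤ n) :
    ∃ J : Finset ℤ, J.card = n ∧ dilateSet k F ⊆ J ∧
      Finset.Ico (-(i * r) : ℤ) (i * r) ⊆ J := by
  have hcard : (dilateSet k F ∪ Finset.Ico (-(i * r) : ℤ) (i * r)).card ≤ n := by
    calc _ ≤ (dilateSet k F).card + (Finset.Ico (-(i * r) : ℤ) (i * r)).card :=
          Finset.card_union_le _ _
      _ ≤ r * F.card + 2 * i * r := by
        gcongr
        · exact (card_dilateSet_le k F).trans (Nat.mul_le_mul_right _ hkr)
        · rw [Int.card_Ico, Int.toNat_le]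
          push_cast
          linarith
      _ ≤ n := by linarith
  obtain ⟨J, hsub, hJ⟩ := Infinite.exists_superset_card_eq _ n hcard
  exact ⟨J, hJ, Finset.union_subset_iff.1 hsub⟩

lemma IsMatrixFamily.exists_next_stage (h𝓜 : IsMatrixFamily 𝓜) (hA : HasNoBoundedTrace A)
    (he : IsStarProjection e) (he0 : e ≠ 0) (σ : MatrixStage 𝓜 e) (i : ℕ) {U : Set A}
    (hU : IsOpen U) (hU' : U.Nonempty) :
    ∃ (τ : MatrixStage 𝓜 e) (k : ℕ+), τ.rank = k * σ.rank ∧ dilateSet k σ.supp ⊆ τ.supp ∧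
      (∀ T, τ.embed (dilate k τ.supp T) = σ.embed T) ∧
      Finset.Ico (-(i * τ.rank) : ℤ) (i * τ.rank) ⊆ τ.supp ∧
      (U ∩ Set.range τ.embed).Nonempty := by
  obtain ⟨a, haU, M, hM, haM⟩ := h𝓜.dense.inter_open_nonempty U hU hU'
  obtain ⟨M₁, hM₁, hσM, hMM⟩ := h𝓜.directed _ σ.range_mem M hM
  have heM : e ∈ M₁ := hσM ⟨σ.proj, σ.embed_proj⟩
  have heM' : IsStarProjection (⟨e, heM⟩ : M₁) :=
    ⟨Subtype.ext he.isIdempotentElem, Subtype.ext he.isSelfAdjoint⟩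
  obtain ⟨N, hN, hMN, n, β, hle⟩ := h𝓜.exists_mul_norm_trace_le hA hM₁ heM'
    (fun h => he0 (congrArg Subtype.val h)) (σ.supp.card + 2 * i : ℕ)
  let h : Matrix σ.supp σ.supp ℂ →⋆ₙₐ[ℂ] Matrix (Fin n) (Fin n) ℂ :=
    (β : N →⋆ₙₐ[ℂ] Matrix (Fin n) (Fin n) ℂ).comp
      (NonUnitalStarAlgHom.codRestrict σ.embed N fun T => hMN (hσM ⟨T, rfl⟩))
  have hinj : Function.Injective h := β.injective.comp fun S T hST =>
    σ.injective_embed (congrArg Subtype.val hST)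
  obtain ⟨k, htrace, hbasis⟩ := exists_starAlgEquiv_dilate σ.supp_nonempty h hinj
  have hproj : h σ.proj = β ⟨e, hMN heM⟩ := congrArg β (Subtype.ext σ.embed_proj)
  have hrank : (β ⟨e, hMN heM⟩).trace = (k * σ.rank : ℕ+) := by
    rw [← hproj, htrace, σ.trace_proj, PNat.mul_coe, Nat.cast_mul]
  rw [hrank, Complex.norm_natCast] at hle
  obtain ⟨J, hJ, hkJ, hIco⟩ := exists_dilateSet_subset_Ico_subset (F := σ.supp)
    (k := k) (r := k * σ.rank) (Nat.le_mul_of_pos_right _ σ.rank.pos) (i := i) (n := n)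
    (by exact_mod_cast hle)
  obtain ⟨u, hu, hudilate⟩ := hbasis J hJ hkJ
  let ε : Matrix J J ℂ →⋆ₙₐ[ℂ] A := (NonUnitalStarSubalgebraClass.subtype N).comp
    ((β.trans u).symm : Matrix J J ℂ →⋆ₙₐ[ℂ] N)
  have hε (x : N) : ε (u (β x)) = x := congrArg Subtype.val ((β.trans u).symm_apply_apply x)
  have hrange : NonUnitalStarAlgHom.range ε = N := by
    refine le_antisymm ?_ fun x hx => ⟨_, hε ⟨x, hx⟩⟩
    rintro _ ⟨T, rfl⟩
    exact ((β.trans u).symm T).2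
  refine ⟨⟨J, ε, Subtype.val_injective.comp (β.trans u).symm.injective, hrange ▸ hN,
    u (β ⟨e, hMN heM⟩), hε _, k * σ.rank, (hu _).trans hrank⟩, k, rfl, hkJ, fun T => ?_, hIco,
    a, haU, ⟨_, hε ⟨a, hMN (hMM haM)⟩⟩⟩
  rw [← hudilate]
  exact hε _

lemma IsMatrixFamily.exists_initial_stage (h𝓜 : IsMatrixFamily 𝓜) :
    ∃ e : A, IsStarProjection e ∧ e ≠ 0 ∧ Nonempty (MatrixStage 𝓜 e) := by
  obtain ⟨_, M, hM, -⟩ := h𝓜.dense.nonempty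
  obtain ⟨n, hn, ⟨β⟩⟩ := h𝓜.exists_equiv M hM
  let F : Finset ℤ := Finset.Ico 0 n
  let ι : Fin n ≃ F := (Finset.equivFinOfCardEq (by simp [F])).symm
  let α : M ≃⋆ₐ[ℂ] Matrix F F ℂ :=
    β.trans (StarAlgEquiv.ofAlgEquiv (Matrix.reindexAlgEquiv ℂ ℂ ι) fun _ => rfl)
  let ε : Matrix F F ℂ →⋆ₙₐ[ℂ] A :=
    (NonUnitalStarSubalgebraClass.subtype M).comp (α.symm : Matrix F F ℂ →⋆ₙₐ[ℂ] M)
  have hε : Function.Injective ε := Subtype.val_injective.comp α.symm.injective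
  have hrange : NonUnitalStarAlgHom.range ε = M := by
    refine le_antisymm ?_ fun x hx => ⟨α ⟨x, hx⟩, congrArg Subtype.val (α.symm_apply_apply _)⟩
    rintro _ ⟨T, rfl⟩
    exact (α.symm T).2
  let o : F := ι ⟨0, hn⟩
  have hproj : IsStarProjection (single o o (1 : ℂ)) :=
    ⟨isIdempotentElem_single o, by simp [IsSelfAdjoint, star_eq_conjTranspose]⟩
  have hproj0 : single o o (1 : ℂ) ≠ 0 := fun h =>
    one_ne_zero (α := ℂ) (by simpa using congrFun₂ h o o)
  exact ⟨ε (single o o 1), hproj.map ε, (map_ne_zero_iff ε hε).2 hproj0,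
    ⟨⟨F, ε, hε, hrange ▸ hM, single o o 1, rfl, 1, by simp⟩⟩⟩

lemma IsInfiniteSeparableMatroid.exists_matrixTower (hA : IsInfiniteSeparableMatroid A) :
    Nonempty (MatrixTower A) := by
  have := hA.separable
  have := UniformSpace.secondCountable_of_separable A
  obtain ⟨𝓜, hdir, hmat, hdense⟩ := hA.matroid
  have h𝓜 : IsMatrixFamily 𝓜 := ⟨hdir, hmat, hdense⟩
  obtain ⟨e, he, he0, ⟨σ₀⟩⟩ := h𝓜.exists_initial_stage
  have hbasis := TopologicalSpace.isBasis_countableBasis A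
  obtain ⟨U₀, hU₀, -⟩ := hbasis.exists_subset_of_mem_open (Set.mem_univ (0 : A)) isOpen_univ
  obtain ⟨U, hU⟩ := (TopologicalSpace.countable_countableBasis A).exists_eq_range ⟨U₀, hU₀⟩
  have hUmem (i : ℕ) : U i ∈ TopologicalSpace.countableBasis A := hU ▸ ⟨i, rfl⟩
  choose next ratio hrank hsupp hembed hIco hmeet using fun i σ =>
    h𝓜.exists_next_stage hA.infinite he he0 σ i (hbasis.isOpen (hUmem i))
      (TopologicalSpace.nonempty_of_mem_countableBasis (hUmem i))
  let σ (i : ℕ) : MatrixStage 𝓜 e := i.rec σ₀ next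
  refine ⟨⟨fun i => (σ i).supp, fun i => (σ i).embed, fun i => (σ i).injective_embed,
    fun i => (σ i).rank, fun i => ratio i (σ i), fun i => hrank i (σ i), fun i => hsupp i (σ i),
    fun i => hembed i (σ i), fun i => hIco i (σ i), hbasis.dense_iff.2 fun V hV _ => ?_⟩⟩
  obtain ⟨i, rfl⟩ := hU ▸ hV
  exact (hmeet i (σ i)).mono <| Set.inter_subset_inter_right _ <|
    Set.subset_iUnion (fun j => Set.range (σ j).embed) (i + 1)

end MatrixTowers

section Fractions

/-- The positive rational numbers with a denominator in the sequence `K`, with `ℕ+` acting by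
multiplication. -/
def PosFraction (K : ℕ → ℕ+) : Type :=
  {q : ℚ // ∃ (n : ℕ) (m : ℕ+), q = m / K n}

namespace PosFraction

variable {K : ℕ → ℕ+}

instance : MulAction ℕ+ (PosFraction K) where
  smul k q := ⟨k * q.1, by
    obtain ⟨n, m, h⟩ := q.2
    exact ⟨n, k * m, by rw [h, PNat.mul_coe, Nat.cast_mul, mul_div_assoc]⟩⟩
  one_smul q := Subtype.ext (show ((1 : ℕ+) : ℕ) * q.1 = q.1 by simp)
  mul_smul k l q := Subtype.ext (show ((k * l : ℕ+) : ℕ) * q.1 = k * (l * q.1) by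
    rw [PNat.mul_coe, Nat.cast_mul, mul_assoc])

/-- The fraction `1 / K n`. -/
def unit (K : ℕ → ℕ+) (n : ℕ) : PosFraction K := ⟨1 / K n, n, 1, by simp⟩

lemma coe_smul (k : ℕ+) (q : PosFraction K) : (k • q).1 = k * q.1 := rfl

lemma exists_eq_smul_unit (q : PosFraction K) : ∃ (n : ℕ) (m : ℕ+), q = m • unit K n := by
  obtain ⟨q, n, m, rfl⟩ := q
  exact ⟨n, m, Subtype.ext (by rw [coe_smul, unit, mul_one_div])⟩

lemma smul_unit {n l : ℕ} {k : ℕ+} (h : K l = K n * k) : k • unit K l = unit K n := by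
  refine Subtype.ext ?_
  change (k * (1 / K l) : ℚ) = 1 / K n
  rw [h, PNat.mul_coe, Nat.cast_mul]
  field_simp

lemma isFlatAction (hK : ∀ n, K n ∣ K (n + 1)) : IsFlatAction (PosFraction K) where
  nonempty := ⟨unit K 0⟩
  exists_common x y := by
    obtain ⟨n, m, rfl⟩ := exists_eq_smul_unit x
    obtain ⟨n', m', rfl⟩ := exists_eq_smul_unit y
    obtain ⟨j, hj⟩ := Nat.rel_of_forall_rel_succ_of_le (· ∣ ·) hK (le_max_left n n')
    obtain ⟨j', hj'⟩ := Nat.rel_of_forall_rel_succ_of_le (· ∣ ·) hK (le_max_right n n')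
    exact ⟨unit K (max n n'), m * j, m' * j', by rw [mul_smul, smul_unit hj],
      by rw [mul_smul, smul_unit hj']⟩
  free x k l h := by
    obtain ⟨q, n, m, rfl⟩ := x
    have hq : (m / K n : ℚ) ≠ 0 := by positivity
    exact PNat.coe_injective (by exact_mod_cast mul_right_cancel₀ hq (congrArg Subtype.val h))

end PosFraction

end Fractions

section Existence

open Matrix

lemma exists_dilateSet_subset_Ico (F : Finset ℤ) :
    ∃ n : ℕ, ∀ k : ℕ+, dilateSet k F ⊆ Finset.Ico (-(n * k) : ℤ) (n * k) := by
  refine ⟨F.sup Int.natAbs + 1, fun k p hp => ?_⟩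
  have hk : (0 : ℤ) < k := by exact_mod_cast k.pos
  have hle : (p / k).natAbs ≤ F.sup Int.natAbs := Finset.le_sup (mem_dilateSet.1 hp)
  rw [Finset.mem_Ico, ← neg_mul, ← Int.le_ediv_iff_mul_le hk, ← Int.ediv_lt_iff_lt_mul hk]
  omega

namespace MatrixTower

variable {A : Type*} [NonUnitalCStarAlgebra A] (𝒯 : MatrixTower A)

lemma rank_dvd_succ (n : ℕ) : 𝒯.rank n ∣ 𝒯.rank (n + 1) := Dvd.intro_left _ (𝒯.rank_succ n).symm

lemma exists_dilateSet_subset_supp (F : Finset ℤ) (N : ℕ) (m : ℕ+) :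
    ∃ (l : ℕ) (j : ℕ+), 𝒯.rank l = 𝒯.rank N * j ∧ dilateSet (m * j) F ⊆ 𝒯.supp l := by
  obtain ⟨n, hn⟩ := exists_dilateSet_subset_Ico F
  let i := max N (n * m)
  obtain ⟨j, hj⟩ : 𝒯.rank N ∣ 𝒯.rank (i + 1) :=
    Nat.rel_of_forall_rel_succ_of_le (· ∣ ·) 𝒯.rank_dvd_succ
      ((le_max_left _ _).trans (Nat.le_succ i))
  refine ⟨i + 1, j, hj, (hn _).trans (.trans ?_ (𝒯.Ico_subset i))⟩
  have hle : n * (m * j : ℕ+) ≤ i * (𝒯.rank (i + 1) : ℕ) := by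
    rw [PNat.mul_coe, ← mul_assoc, hj, PNat.mul_coe]
    exact Nat.mul_le_mul (le_max_right _ _) (Nat.le_mul_of_pos_left _ (𝒯.rank N).pos)
  have hle' : (n * (m * j : ℕ+) : ℤ) ≤ i * 𝒯.rank (i + 1) := by exact_mod_cast hle
  exact Finset.Ico_subset_Ico (neg_le_neg hle') hle'

variable {B : Type*} [NonUnitalCStarAlgebra B]

/-- The corner of `Φ` that corresponds to a stage of the tower. -/
noncomputable def stageBlock (Φ : FrobSystem (PosFraction 𝒯.rank) B) (n : ℕ) :
    Matrix (𝒯.supp n) (𝒯.supp n) ℂ →⋆ₙₐ[ℂ] B :=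
  Φ.block (PosFraction.unit 𝒯.rank n) (𝒯.supp n)

lemma stageBlock_dilate (Φ : FrobSystem (PosFraction 𝒯.rank) B) {l N : ℕ} {F : Finset ℤ}
    {m j : ℕ+} (hj : 𝒯.rank l = 𝒯.rank N * j)
    (hF : dilateSet (m * j) F ⊆ 𝒯.supp l) (T : Matrix F F ℂ) :
    𝒯.stageBlock Φ l (dilate (m * j) (𝒯.supp l) T) =
      Φ.block (m • PosFraction.unit 𝒯.rank N) F T := by
  rw [stageBlock, ← Φ.block_smul _ _ hF, mul_smul, PosFraction.smul_unit hj]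

lemma dense_iUnion_range_stageBlock (Φ : FrobSystem (PosFraction 𝒯.rank) B) :
    Dense (⋃ n, Set.range (𝒯.stageBlock Φ n)) := by
  refine Metric.dense_iff.2 fun b ε hε => ?_
  obtain ⟨x, F, -, T, hT⟩ := Φ.exists_block_near b hε
  obtain ⟨N, m, rfl⟩ := x.exists_eq_smul_unit
  obtain ⟨l, j, hj, hF⟩ := 𝒯.exists_dilateSet_subset_supp F N m
  refine ⟨_, Metric.mem_ball'.2 hT, Set.mem_iUnion.2 ⟨l, dilate (m * j) (𝒯.supp l) T, ?_⟩⟩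
  exact 𝒯.stageBlock_dilate Φ hj hF T

open scoped Matrix.Norms.L2Operator in
lemma nonempty_starAlgEquiv (Φ : FrobSystem (PosFraction 𝒯.rank) B) :
    Nonempty (A ≃⋆ₐ[ℂ] B) := by
  let f (n : ℕ) : Matrix (𝒯.supp n) (𝒯.supp n) ℂ →⋆ₙₐ[ℂ] A × B :=
    (𝒯.embed n).prod (𝒯.stageBlock Φ n)
  let R (n : ℕ) : NonUnitalStarSubalgebra ℂ (A × B) := NonUnitalStarAlgHom.range (f n)
  have hR : Monotone R := by
    refine monotone_nat_of_le_succ fun n => ?_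
    rintro _ ⟨T, rfl⟩
    refine ⟨dilate (𝒯.ratio n) (𝒯.supp (n + 1)) T, Prod.ext (𝒯.embed_dilate n T) ?_⟩
    have h := 𝒯.stageBlock_dilate Φ (m := 1) ((𝒯.rank_succ n).trans (mul_comm _ _))
      ((one_mul (𝒯.ratio n)).symm ▸ 𝒯.dilateSet_subset n) T
    rwa [one_mul, one_smul] at h
  have hcoe : ((⨆ n, R n : NonUnitalStarSubalgebra ℂ (A × B)) : Set (A × B)) =
      ⋃ n, Set.range (f n) :=
    NonUnitalStarSubalgebra.coe_iSup_of_directed hR.directed_le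
  refine nonempty_starAlgEquiv_of_correspondence (⨆ n, R n) (fun p hp => ?_) ?_ ?_
  · obtain ⟨n, T, rfl⟩ := Set.mem_iUnion.1 (hcoe.subset hp)
    exact (NonUnitalStarAlgHom.norm_map _ (𝒯.injective_embed n) T).trans
      (NonUnitalStarAlgHom.norm_map _ (Φ.block_injective _ _) T).symm
  · simp only [hcoe, Set.image_iUnion, ← Set.range_comp]
    exact 𝒯.dense
  · simp only [hcoe, Set.image_iUnion, ← Set.range_comp]
    exact 𝒯.dense_iUnion_range_stageBlock Φ

end MatrixTower

lemma IsInfiniteSeparableMatroid.exists_flat {A : Type*} [NonUnitalCStarAlgebra A]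
    (hA : IsInfiniteSeparableMatroid A) :
    ∃ (X : Type) (_ : MulAction ℕ+ X), IsFlatAction X ∧
      ∀ (B : Type) [NonUnitalCStarAlgebra B], FrobSystem X B → Nonempty (A ≃⋆ₐ[ℂ] B) := by
  obtain ⟨𝒯⟩ := hA.exists_matrixTower
  exact ⟨PosFraction 𝒯.rank, inferInstance, PosFraction.isFlatAction 𝒯.rank_dvd_succ,
    fun B _ Φ => 𝒯.nonempty_starAlgEquiv Φ⟩

end Existence

section OperatorAlgebraObj

open CategoryTheory MonoidalCategory CartesianMonoidalCategory

/-- A section of the object `𝒦`, as an element of the algebra of compact operators. -/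
noncomputable def sectionOp {c : (SingleObj ℕ+)ᵒᵖ} (x : compactPresheaf.obj c) : KAlg :=
  ⟨opOf x, Subtype.prop (p := fun T => T ∈ CompactOps) x⟩

/-- A compact operator, as a section of the object `𝒦`. -/
noncomputable def opSection (c : (SingleObj ℕ+)ᵒᵖ) (x : KAlg) : compactPresheaf.obj c :=
  show CompactOps from ⟨x.1, x.2⟩

lemma compactPresheaf_hom_ext {T : (SingleObj ℕ+)ᵒᵖ ⥤ Type} {f g : T ⟶ compactPresheaf}
    (h : ∀ c (t : T.obj c), sectionOp (f.app c t) = sectionOp (g.app c t)) : f = g := by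
  ext c t
  exact congrArg (opSection c) (h c t)

/-- The endomorphism of the object `𝒦` given by an equivariant map on the compact operators. -/
noncomputable def unaryOp (m : KAlg → KAlg) (hm : ∀ k x, frob k (m x) = m (frob k x)) :
    compactPresheaf ⟶ compactPresheaf where
  app c := TypeCat.ofHom fun x => opSection c (m (sectionOp x))
  naturality _ _ k := by
    ext x
    exact congrArg (opSection _) (hm k.unop (sectionOp x)).symm

/-- The binary operation on the object `𝒦` given by an equivariant one on the compact operators. -/
noncomputable def binaryOp (m : KAlg → KAlg → KAlg)
    (hm : ∀ k x y, frob k (m x y) = m (frob k x) (frob k y)) :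
    compactPresheaf ⊗ compactPresheaf ⟶ compactPresheaf where
  app c := TypeCat.ofHom fun x => opSection c (m (sectionOp x.1) (sectionOp x.2))
  naturality _ _ k := by
    ext x
    exact congrArg (opSection _) (hm k.unop (sectionOp x.1) (sectionOp x.2)).symm

/-- The zero operator, as a global section of the object `𝒦`. -/
noncomputable def zeroOp : 𝟙_ ((SingleObj ℕ+)ᵒᵖ ⥤ Type) ⟶ compactPresheaf where
  app c := TypeCat.ofHom fun _ => opSection c 0
  naturality _ _ k := by
    ext
    exact congrArg (opSection _) (map_zero (frob k.unop)).symm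

/-- The compact operators, with their usual operations, as an involutive algebra in the topos. -/
noncomputable def operatorAlgebraObj : InvolutiveAlgebraObj compactPresheaf where
  zero := zeroOp
  add := binaryOp (· + ·) fun k x y => map_add (frob k) x y
  neg := unaryOp (- ·) fun k x => map_neg (frob k) x
  smul z := unaryOp (z • ·) fun k x => map_smul (frob k) z x
  mul := binaryOp (· * ·) fun k x y => map_mul (frob k) x y
  star := unaryOp star fun k x => map_star (frob k) x
  add_assoc f g h := compactPresheaf_hom_ext fun c t =>
    add_assoc (sectionOp (f.app c t)) (sectionOp (g.app c t)) (sectionOp (h.app c t))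
  add_comm f g := compactPresheaf_hom_ext fun c t =>
    add_comm (sectionOp (f.app c t)) (sectionOp (g.app c t))
  zero_add f := compactPresheaf_hom_ext fun c t => zero_add (sectionOp (f.app c t))
  neg_add_cancel f := compactPresheaf_hom_ext fun c t => neg_add_cancel (sectionOp (f.app c t))
  one_smul := compactPresheaf_hom_ext fun _ t => one_smul ℂ (sectionOp t)
  mul_smul a b := compactPresheaf_hom_ext fun _ t => mul_smul a b (sectionOp t)
  smul_add a _ f g := compactPresheaf_hom_ext fun c t =>
    smul_add a (sectionOp (f.app c t)) (sectionOp (g.app c t))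
  add_smul a b _ f := compactPresheaf_hom_ext fun c t => add_smul a b (sectionOp (f.app c t))
  mul_assoc f g h := compactPresheaf_hom_ext fun c t =>
    mul_assoc (sectionOp (f.app c t)) (sectionOp (g.app c t)) (sectionOp (h.app c t))
  left_distrib f g h := compactPresheaf_hom_ext fun c t =>
    mul_add (sectionOp (f.app c t)) (sectionOp (g.app c t)) (sectionOp (h.app c t))
  right_distrib f g h := compactPresheaf_hom_ext fun c t =>
    add_mul (sectionOp (f.app c t)) (sectionOp (g.app c t)) (sectionOp (h.app c t))
  smul_mul a _ f g := compactPresheaf_hom_ext fun c t =>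
    smul_mul_assoc a (sectionOp (f.app c t)) (sectionOp (g.app c t))
  mul_smul_comm a _ f g := compactPresheaf_hom_ext fun c t =>
    mul_smul_comm a (sectionOp (f.app c t)) (sectionOp (g.app c t))
  star_star := compactPresheaf_hom_ext fun _ t => star_star (sectionOp t)
  star_add f g := compactPresheaf_hom_ext fun c t =>
    star_add (sectionOp (f.app c t)) (sectionOp (g.app c t))
  star_mul f g := compactPresheaf_hom_ext fun c t =>
    star_mul (sectionOp (f.app c t)) (sectionOp (g.app c t))
  star_smul a := compactPresheaf_hom_ext fun _ t => star_smul a (sectionOp t)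

lemma isOperatorAlgebraObj_operatorAlgebraObj : IsOperatorAlgebraObj operatorAlgebraObj where
  add _ _ := rfl
  smul _ _ := rfl
  mul _ _ := rfl
  star _ := rfl

end OperatorAlgebraObj

section Points

open CategoryTheory

namespace NTimesPoint

/-- The underlying set of the flat functor which gives a point. -/
def Carrier (p : NTimesPoint) : Type := p.fiber.obj (SingleObj.star ℕ+)

instance (p : NTimesPoint) : MulAction ℕ+ p.Carrier where
  smul k x := p.fiber.map (X := SingleObj.star ℕ+) (Y := SingleObj.star ℕ+) k x
  one_smul x := congrArg (fun f => f x) (p.fiber.map_id (SingleObj.star ℕ+))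
  mul_smul k l x := congrArg (fun f => f x) (p.fiber.map_comp (X := SingleObj.star ℕ+)
    (Y := SingleObj.star ℕ+) (Z := SingleObj.star ℕ+) l k)

lemma isFlatAction (p : NTimesPoint) : IsFlatAction p.Carrier where
  nonempty := by
    obtain ⟨⟨⟨⟩, x⟩⟩ := IsCofiltered.nonempty (C := p.fiber.Elements)
    exact ⟨x⟩
  exists_common x y := by
    let x' : p.fiber.Elements := ⟨SingleObj.star ℕ+, x⟩
    let y' : p.fiber.Elements := ⟨SingleObj.star ℕ+, y⟩
    exact ⟨(IsCofiltered.min x' y').2, (IsCofiltered.minToLeft x' y').1,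
      (IsCofiltered.minToRight x' y').1, (IsCofiltered.minToLeft x' y').2,
      (IsCofiltered.minToRight x' y').2⟩
  free x k l h := by
    let x' : p.fiber.Elements := ⟨SingleObj.star ℕ+, x⟩
    let y' : p.fiber.Elements := ⟨SingleObj.star ℕ+, k • x⟩
    let f : x' ⟶ y' := ⟨k, rfl⟩
    let g : x' ⟶ y' := ⟨l, h.symm⟩
    exact mul_right_cancel (b := (show ℕ+ from (IsCofiltered.eqHom f g).1))
      (congrArg (fun u => (u.1 : ℕ+)) (IsCofiltered.eq_condition f g))

-- A morphism of points is a natural transformation of fiber functors in the opposite direction.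
lemma nonempty_iso_of_equiv {p q : NTimesPoint} (g : p.Carrier ≃ q.Carrier)
    (hg : ∀ (k : ℕ+) (x : p.Carrier), g (k • x) = k • g x) : Nonempty (Iso q p) := by
  have hg_symm (k : ℕ+) (x : q.Carrier) : g.symm (k • x) = k • g.symm x := by
    rw [Equiv.symm_apply_eq, hg, g.apply_symm_apply]
  refine ⟨⟨⟨⟨fun _ => TypeCat.ofHom g, fun _ _ k => ?_⟩⟩,
    ⟨⟨fun _ => TypeCat.ofHom g.symm, fun _ _ k => ?_⟩⟩, ?_, ?_⟩⟩
  · ext x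
    exact hg k x
  · ext x
    exact hg_symm k x
  · ext c x
    exact g.apply_symm_apply x
  · ext c x
    exact g.symm_apply_apply x

end NTimesPoint

/-- The functor on the one-object category of `ℕ^×` given by an action of `ℕ^×`. -/
def functorOfMulAction (X : Type*) [MulAction ℕ+ X] : SingleObj ℕ+ ⥤ Type _ where
  obj _ := X
  map k := TypeCat.ofHom fun x => (show ℕ+ from k) • x
  map_id _ := by
    ext x
    exact one_smul ℕ+ x
  map_comp k l := by
    ext x
    exact mul_smul (show ℕ+ from l) (show ℕ+ from k) x

namespace IsFlatAction

lemma isCofiltered_elements {X : Type*} [MulAction ℕ+ X] (hX : IsFlatAction X) :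
    IsCofiltered (functorOfMulAction X).Elements where
  nonempty := by
    obtain ⟨x⟩ := hX.nonempty
    exact ⟨⟨SingleObj.star ℕ+, x⟩⟩
  cone_objs := by
    rintro ⟨⟨⟩, x⟩ ⟨⟨⟩, y⟩
    obtain ⟨z, k, l, hk, hl⟩ := hX.exists_common x y
    exact ⟨⟨SingleObj.star ℕ+, z⟩, ⟨k, hk⟩, ⟨l, hl⟩, trivial⟩
  cone_maps := by
    rintro ⟨⟨⟩, x⟩ ⟨⟨⟩, y⟩ ⟨k, hk⟩ ⟨l, hl⟩
    obtain rfl : k = l := hX.free x k l (hk.trans hl.symm)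
    exact ⟨⟨SingleObj.star ℕ+, x⟩, 𝟙 _, rfl⟩

/-- The point given by a flat action of `ℕ^×`. -/
def toPoint {X : Type} [MulAction ℕ+ X] (hX : IsFlatAction X) : NTimesPoint where
  fiber := functorOfMulAction X
  isCofiltered := hX.isCofiltered_elements
  initiallySmall := initiallySmall_of_essentiallySmall _
  jointly_surjective := by
    intro c R hR x
    obtain rfl : R = ⊤ := by simpa only [GrothendieckTopology.bot_covering] using hR
    exact ⟨c, 𝟙 _, trivial, x, by rw [(functorOfMulAction X).map_id]; rfl⟩

/-- The set underlying the point given by a flat action is the set which is acted on. -/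
def carrierEquiv {X : Type} [MulAction ℕ+ X] (hX : IsFlatAction X) : X ≃ hX.toPoint.Carrier :=
  Equiv.refl X

lemma carrierEquiv_smul {X : Type} [MulAction ℕ+ X] (hX : IsFlatAction X) (k : ℕ+) (x : X) :
    hX.carrierEquiv (k • x) = k • hX.carrierEquiv x := rfl

end IsFlatAction

end Points

section Stalks

open CategoryTheory MonoidalCategory CartesianMonoidalCategory Opposite InvolutiveAlgebraObj

lemma InvolutiveAlgebraObj.el_toPresheafFiber {p : NTimesPoint} {P T : (SingleObj ℕ+)ᵒᵖ ⥤ Type}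
    (S : InvolutiveAlgebraObj P) (f : T ⟶ P) (x : p.Carrier)
    (t : T.obj (op (SingleObj.star ℕ+))) :
    S.el p.presheafFiber f (p.toPresheafFiber _ x T t) = p.toPresheafFiber _ x P (f.app _ t) :=
  p.toPresheafFiber_naturality_apply f _ x t

namespace NTimesPoint

variable (p : NTimesPoint)

/-- The class in the stalk of a compact operator, at an element of the flat functor: the map
which underlies `NTimesPoint.germ`. -/
noncomputable def germFun (x : p.Carrier) (T : KAlg) : operatorAlgebraObj.Stalk p :=
  p.toPresheafFiber (SingleObj.star ℕ+) x compactPresheaf (opSection _ T)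

lemma el_germFun (x : p.Carrier) (f : compactPresheaf ⟶ compactPresheaf) (T : KAlg) :
    operatorAlgebraObj.el p.presheafFiber f (p.germFun x T) =
      p.germFun x (sectionOp (f.app (op (SingleObj.star ℕ+)) (opSection _ T))) :=
  el_toPresheafFiber _ f x _

lemma exists_pair_germFun (x : p.Carrier) (T T' : KAlg) :
    ∃ e, operatorAlgebraObj.el p.presheafFiber (fst compactPresheaf compactPresheaf) e =
        p.germFun x T ∧
      operatorAlgebraObj.el p.presheafFiber (snd compactPresheaf compactPresheaf) e =
        p.germFun x T' ∧
      ∀ m : compactPresheaf ⊗ compactPresheaf ⟶ compactPresheaf,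
        operatorAlgebraObj.el p.presheafFiber (lift (fst _ _) (snd _ _) ≫ m) e =
          p.germFun x
            (sectionOp (m.app (op (SingleObj.star ℕ+)) (opSection _ T, opSection _ T'))) := by
  let t : (compactPresheaf ⊗ compactPresheaf).obj (op (SingleObj.star ℕ+)) :=
    (opSection _ T, opSection _ T')
  exact ⟨p.toPresheafFiber _ x (compactPresheaf ⊗ compactPresheaf) t,
    el_toPresheafFiber _ _ x t, el_toPresheafFiber _ _ x t, fun m => el_toPresheafFiber _ _ x t⟩

/-- The homomorphism from `𝒦` to its stalk at a point, for an element of the flat functor. -/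
noncomputable def germ (x : p.Carrier) : KAlg →⋆ₙₐ[ℂ] operatorAlgebraObj.Stalk p where
  toFun := p.germFun x
  map_smul' z T := by
    have h := operatorAlgebraObj.fiber_smul p.presheafFiber z (𝟙 _) (p.germFun x T)
    rw [el_germFun, el_germFun] at h
    exact h.symm
  map_zero' := by
    have h := operatorAlgebraObj.fiber_zero p.presheafFiber (p.germFun x 0)
    rw [el_germFun] at h
    exact h.symm
  map_add' T T' := by
    obtain ⟨e, hfst, hsnd, hop⟩ := p.exists_pair_germFun x T T'
    have h := operatorAlgebraObj.fiber_add p.presheafFiber (fst _ _) (snd _ _) e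
    rw [hfst, hsnd, hop] at h
    exact h.symm
  map_mul' T T' := by
    obtain ⟨e, hfst, hsnd, hop⟩ := p.exists_pair_germFun x T T'
    have h := operatorAlgebraObj.fiber_mul p.presheafFiber (fst _ _) (snd _ _) e
    rw [hfst, hsnd, hop] at h
    exact h.symm
  map_star' T := by
    have h := operatorAlgebraObj.fiber_star p.presheafFiber (𝟙 _) (p.germFun x T)
    rw [el_germFun, el_germFun] at h
    exact h.symm

lemma germ_smul (k : ℕ+) (x : p.Carrier) (T : KAlg) : p.germ (k • x) T = p.germ x (frob k T) :=
  (p.toPresheafFiber_w_apply (X := SingleObj.star ℕ+) (Y := SingleObj.star ℕ+) k x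
    compactPresheaf (opSection _ T)).symm

lemma germ_injective (x : p.Carrier) : Function.Injective (p.germ x) := by
  intro T T' h
  obtain ⟨⟨⟩, k, y, -, hk⟩ := (p.toPresheafFiber_eq_iff' (P := compactPresheaf)
    (SingleObj.star ℕ+) x (opSection _ T) (opSection _ T')).1 h
  exact frob_injective k hk

lemma exists_germ_eq (s : operatorAlgebraObj.Stalk p) : ∃ x T, p.germ x T = s := by
  obtain ⟨⟨⟩, x, T, h⟩ := p.toPresheafFiber_jointly_surjective (P := compactPresheaf) s
  exact ⟨x, sectionOp T, h⟩

lemma exists_germ_eq₂ (s t : operatorAlgebraObj.Stalk p) :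
    ∃ x T T', p.germ x T = s ∧ p.germ x T' = t := by
  obtain ⟨x, T, rfl⟩ := p.exists_germ_eq s
  obtain ⟨y, T', rfl⟩ := p.exists_germ_eq t
  obtain ⟨z, k, l, rfl, rfl⟩ := p.isFlatAction.exists_common x y
  exact ⟨z, frob k T, frob l T', (p.germ_smul k z T).symm, (p.germ_smul l z T').symm⟩

end NTimesPoint

end Stalks

section CStarCompletion

open UniformSpace UniformSpace.Completion

section Mul

variable (S : Type v) [NonUnitalNormedRing S] [NormedSpace ℂ S]
  [IsScalarTower ℂ S S] [SMulCommClass ℂ S S]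

/-- The multiplication of the completion of a non-unital normed algebra, as a bilinear map: the
library only multiplies in the completion of a unital ring. -/
noncomputable def completionMul : Completion S →L[ℂ] Completion S →L[ℂ] Completion S :=
  ((((ContinuousLinearMap.compL ℂ S S (Completion S) toComplL).comp
    (ContinuousLinearMap.mul ℂ S)).flip.extend toComplL).flip).extend toComplL

variable {S}

lemma completionMul_coe (a b : S) : completionMul S a b = ((a * b : S) : Completion S) := by
  have hd : DenseRange (toComplL : S →L[ℂ] Completion S) := denseRange_coe
  have hu : IsUniformInducing (toComplL : S →L[ℂ] Completion S) := isUniformInducing_coe S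
  have hleft : completionMul S a = _ := ContinuousLinearMap.extend_eq _ hd hu a
  have hright := ContinuousLinearMap.extend_eq ((ContinuousLinearMap.compL ℂ S S (Completion S)
    toComplL).comp (ContinuousLinearMap.mul ℂ S)).flip hd hu b
  rw [hleft, ContinuousLinearMap.flip_apply]
  exact congrArg (fun f => f a) hright

/-- The completion of a non-unital normed algebra, as a non-unital normed ring. -/
noncomputable abbrev completionNonUnitalNormedRing : NonUnitalNormedRing (Completion S) where
  __ := (inferInstance : NormedAddCommGroup (Completion S))
  mul x y := completionMul S x y
  left_distrib x y z := map_add (completionMul S x) y z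
  right_distrib x y z := congrArg (fun f => f z) (map_add (completionMul S) x y)
  zero_mul x := congrArg (fun f => f x) (map_zero (completionMul S))
  mul_zero x := map_zero (completionMul S x)
  mul_assoc x y z := by
    change completionMul S (completionMul S x y) z = completionMul S x (completionMul S y z)
    induction x, y, z using Completion.induction_on₃ with
    | hp => exact isClosed_eq (by fun_prop) (by fun_prop)
    | ih a b c => simp only [completionMul_coe, mul_assoc]
  norm_mul_le x y := by
    change ‖completionMul S x y‖ ≤ ‖x‖ * ‖y‖
    induction x, y using Completion.induction_on₂ with
    | hp => exact isClosed_le (by fun_prop) (by fun_prop)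
    | ih a b =>
      rw [completionMul_coe, norm_coe, norm_coe, norm_coe]
      exact norm_mul_le a b

attribute [local instance] completionNonUnitalNormedRing

lemma completion_mul_def (x y : Completion S) : x * y = completionMul S x y := rfl

lemma completion_isScalarTower : IsScalarTower ℂ (Completion S) (Completion S) where
  smul_assoc c x y := congrArg (fun f => f y) (map_smul (completionMul S) c x)

lemma completion_smulCommClass : SMulCommClass ℂ (Completion S) (Completion S) where
  smul_comm c x y := (map_smul (completionMul S x) c y).symm

end Mul

attribute [local instance] completionNonUnitalNormedRing

section Star

variable {S : Type v} [NonUnitalNormedRing S] [StarRing S] [CStarRing S]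

lemma completion_map_star_coe (a : S) :
    Completion.map star (a : Completion S) = ((star a : S) : Completion S) :=
  Completion.map_coe star_isometry.uniformContinuous a

variable [NormedSpace ℂ S] [IsScalarTower ℂ S S] [SMulCommClass ℂ S S]

attribute [local fun_prop] UniformSpace.Completion.continuous_map

/-- The involution of the completion of an algebra with a C*-norm. -/
noncomputable abbrev completionStarRing : StarRing (Completion S) where
  star := Completion.map star
  star_involutive x := by
    induction x using Completion.induction_on with
    | hp => exact isClosed_eq (by fun_prop) (by fun_prop)
    | ih a => rw [completion_map_star_coe, completion_map_star_coe, star_star]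
  star_mul x y := by
    simp only [completion_mul_def]
    induction x, y using Completion.induction_on₂ with
    | hp => exact isClosed_eq (by fun_prop) (by fun_prop)
    | ih a b => simp only [completionMul_coe, completion_map_star_coe, star_mul]
  star_add x y := by
    induction x, y using Completion.induction_on₂ with
    | hp => exact isClosed_eq (by fun_prop) (by fun_prop)
    | ih a b => simp only [← Completion.coe_add, completion_map_star_coe, star_add]

attribute [local instance] completionStarRing

lemma completion_star_coe (a : S) : star (a : Completion S) = ((star a : S) : Completion S) :=
  completion_map_star_coe a

lemma continuous_completion_star : Continuous (star : Completion S → Completion S) :=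
  continuous_map

lemma completion_cstarRing : CStarRing (Completion S) where
  norm_mul_self_le x := by
    have hc := continuous_completion_star (S := S)
    rw [completion_mul_def]
    induction x using Completion.induction_on with
    | hp => exact isClosed_le (by fun_prop) (by fun_prop)
    | ih a =>
      rw [completion_star_coe, completionMul_coe, norm_coe, norm_coe]
      exact CStarRing.norm_mul_self_le a

lemma completion_starModule [StarModule ℂ S] : StarModule ℂ (Completion S) where
  star_smul c x := by
    have hc := continuous_completion_star (S := S)
    induction x using Completion.induction_on with
    | hp => exact isClosed_eq (hc.comp (continuous_const_smul c)) (hc.const_smul (star c))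
    | ih a =>
      rw [← Completion.coe_smul, completion_star_coe, completion_star_coe, star_smul,
        Completion.coe_smul]

/-- The completion of an algebra with a C*-norm, as a C*-algebra. -/
noncomputable abbrev completionCStarAlgebra [StarModule ℂ S] :
    NonUnitalCStarAlgebra (Completion S) :=
  { completionNonUnitalNormedRing, completionStarRing, completion_cstarRing,
    completion_isScalarTower, completion_smulCommClass, completion_starModule,
    (inferInstance : NormedSpace ℂ (Completion S)),
    (inferInstance : CompleteSpace (Completion S)) with }

end Star

theorem exists_cstarAlgebra_of_norm {S : Type v} [NonUnitalRing S] [StarRing S] [Module ℂ S]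
    [IsScalarTower ℂ S S] [SMulCommClass ℂ S S] [StarModule ℂ S] (N : S → ℝ)
    (hadd : ∀ x y, N (x + y) ≤ N x + N y) (hsmul : ∀ (c : ℂ) x, N (c • x) = ‖c‖ * N x)
    (hzero : ∀ x, N x = 0 → x = 0) (hmul : ∀ x y, N (x * y) ≤ N x * N y)
    (hstar : ∀ x, N x * N x ≤ N (star x * x)) :
    ∃ (B : Type v) (_ : NonUnitalCStarAlgebra B) (φ : S →⋆ₙₐ[ℂ] B),
      (∀ x, ‖φ x‖ = N x) ∧ DenseRange φ := by
  let groupNorm : AddGroupNorm S :=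
    { toFun := N
      map_zero' := by simpa using hsmul 0 0
      add_le' := hadd
      neg' := fun x => by simpa using hsmul (-1) x
      eq_zero_of_map_eq_zero' := hzero }
  let _ : NonUnitalNormedRing S :=
    { groupNorm.toNormedAddCommGroup, ‹NonUnitalRing S› with
      norm_mul_le := hmul }
  let _ : NormedSpace ℂ S := { norm_smul_le := fun c x => (hsmul c x).le }
  have _ : CStarRing S := ⟨hstar⟩
  let _ : NonUnitalCStarAlgebra (Completion S) := completionCStarAlgebra
  refine ⟨Completion S, inferInstance,
    { toFun := fun x => (x : Completion S)
      map_smul' := fun c x => Completion.coe_smul c x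
      map_zero' := Completion.coe_zero
      map_add' := fun x y => Completion.coe_add x y
      map_mul' := fun x y => (completionMul_coe x y).symm
      map_star' := fun x => (completion_map_star_coe x).symm }, fun x => Completion.norm_coe x,
    Completion.denseRange_coe⟩

end CStarCompletion

section SpectralNorm

lemma isGreatest_sqrt_norm_spectrum {A : Type*} [NonUnitalCStarAlgebra A] (a : A) :
    IsGreatest ((fun z : ℂ => √‖z‖) '' spectrum ℂ ((star a * a : A) : Unitization ℂ A)) ‖a‖ := by
  have hnorm : ‖((star a * a : A) : Unitization ℂ A)‖ = ‖a‖ * ‖a‖ := by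
    rw [Unitization.norm_inr, CStarRing.norm_star_mul_self]
  constructor
  · obtain ⟨z, hz, h⟩ := spectrum.exists_nnnorm_eq_spectralRadius
      ((star a * a : A) : Unitization ℂ A)
    rw [((IsSelfAdjoint.star_mul_self a).inr ℂ).spectralRadius_eq_nnnorm] at h
    have hz_norm : ‖z‖ = ‖a‖ * ‖a‖ :=
      (congrArg NNReal.toReal (ENNReal.coe_injective h)).trans hnorm
    exact ⟨z, hz, by simp only [hz_norm, Real.sqrt_mul_self (norm_nonneg a)]⟩
  · rintro _ ⟨z, hz, rfl⟩
    refine Real.sqrt_le_iff.2 ⟨norm_nonneg a, ?_⟩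
    rw [sq, ← hnorm]
    exact spectrum.norm_le_norm_of_mem hz

lemma IsCStarCompletion.trans_starAlgEquiv {S A B : Type*} [NonUnitalRing S] [StarRing S]
    [Module ℂ S] [IsScalarTower ℂ S S] [SMulCommClass ℂ S S] [NonUnitalCStarAlgebra A]
    [NonUnitalCStarAlgebra B] {φ : S →⋆ₙₐ[ℂ] B} (h : IsCStarCompletion φ) (g : B ≃⋆ₐ[ℂ] A) :
    IsCStarCompletion ((g : B →⋆ₙₐ[ℂ] A).comp φ) where
  injective := g.injective.comp h.injective
  denseRange := g.surjective.denseRange.comp h.denseRange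
    (NonUnitalStarAlgHom.isometry (g : B →⋆ₙₐ[ℂ] A) g.injective).continuous
  isLUB_norm x := by
    have hnorm : ‖((g : B →⋆ₙₐ[ℂ] A).comp φ) x‖ = ‖φ x‖ :=
      NonUnitalStarAlgHom.norm_map (g : B →⋆ₙₐ[ℂ] A) g.injective (φ x)
    exact hnorm ▸ h.isLUB_norm x

end SpectralNorm

section StalkCompletion

lemma norm_frob (k : ℕ+) (T : KAlg) : ‖frob k T‖ = ‖T‖ :=
  NonUnitalStarAlgHom.norm_map (frob k) (frob_injective k) T

namespace NTimesPoint

variable (p : NTimesPoint)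

lemma norm_eq_of_germ_eq {x y : p.Carrier} {T T' : KAlg} (h : p.germ x T = p.germ y T') :
    ‖T‖ = ‖T'‖ := by
  obtain ⟨z, k, l, rfl, rfl⟩ := p.isFlatAction.exists_common x y
  rw [germ_smul, germ_smul] at h
  rw [← norm_frob k, p.germ_injective z h, norm_frob]

lemma exists_stalk_norm :
    ∃ N : operatorAlgebraObj.Stalk p → ℝ, ∀ x T, N (p.germ x T) = ‖T‖ := by
  choose x T hT using p.exists_germ_eq
  exact ⟨fun s => ‖T s‖, fun _ _ => p.norm_eq_of_germ_eq (hT _)⟩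

lemma exists_stalk_completion : ∃ (B : Type) (_ : NonUnitalCStarAlgebra B)
    (φ : operatorAlgebraObj.Stalk p →⋆ₙₐ[ℂ] B),
    (∀ x T, ‖φ (p.germ x T)‖ = ‖T‖) ∧ DenseRange φ := by
  obtain ⟨N, hN⟩ := p.exists_stalk_norm
  obtain ⟨B, _, φ, hφ, hdense⟩ := exists_cstarAlgebra_of_norm N
    (fun s t => by
      obtain ⟨x, T, T', rfl, rfl⟩ := p.exists_germ_eq₂ s t
      simp only [← map_add, hN]
      exact norm_add_le T T')
    (fun c s => by
      obtain ⟨x, T, rfl⟩ := p.exists_germ_eq s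
      simp only [← map_smul, hN]
      exact norm_smul c T)
    (fun s hs => by
      obtain ⟨x, T, rfl⟩ := p.exists_germ_eq s
      rw [norm_eq_zero.1 ((hN x T).symm.trans hs), map_zero])
    (fun s t => by
      obtain ⟨x, T, T', rfl, rfl⟩ := p.exists_germ_eq₂ s t
      simp only [← map_mul, hN]
      exact norm_mul_le T T')
    (fun s => by
      obtain ⟨x, T, rfl⟩ := p.exists_germ_eq s
      rw [← map_star (p.germ x), ← map_mul, hN, hN]
      exact CStarRing.norm_mul_self_le T)
  exact ⟨B, _, φ, fun x T => (hφ _).trans (hN x T), hdense⟩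

lemma exists_isCStarCompletion : ∃ (B : Type) (_ : NonUnitalCStarAlgebra B)
    (φ : operatorAlgebraObj.Stalk p →⋆ₙₐ[ℂ] B), IsCStarCompletion φ := by
  obtain ⟨B, _, φ, hnorm, hdense⟩ := p.exists_stalk_completion
  refine ⟨B, _, φ, (injective_iff_map_eq_zero φ).2 fun s hs => ?_, hdense, fun s => ?_⟩ <;>
    obtain ⟨x, T, rfl⟩ := p.exists_germ_eq s
  · have hT : ‖T‖ = 0 := by rw [← hnorm x, hs, norm_zero]
    rw [norm_eq_zero.1 hT, map_zero]
  · -- The spectrum in the stalk lies between the spectra in `B` and in `𝒦`.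
    rw [← Unitization.quasispectrum_eq_spectrum_inr]
    refine IsGreatest.isLUB ⟨?_, ?_⟩
    · refine Set.image_mono ?_ (isGreatest_sqrt_norm_spectrum (φ (p.germ x T))).1
      rw [← Unitization.quasispectrum_eq_spectrum_inr, ← map_star φ, ← map_mul]
      exact NonUnitalAlgHom.quasispectrum_apply_subset φ _
    · rw [hnorm]
      refine upperBounds_mono_set (Set.image_mono ?_) (isGreatest_sqrt_norm_spectrum T).2
      rw [← Unitization.quasispectrum_eq_spectrum_inr, ← map_star (p.germ x), ← map_mul]
      exact NonUnitalAlgHom.quasispectrum_apply_subset (p.germ x) _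

end NTimesPoint

/-- The completion of the stalk at a point, as an inductive limit of copies of `𝒦`. -/
noncomputable def IsCStarCompletion.frobSystem {p : NTimesPoint} {B : Type*}
    [NonUnitalCStarAlgebra B] {φ : operatorAlgebraObj.Stalk p →⋆ₙₐ[ℂ] B}
    (h : IsCStarCompletion φ) : FrobSystem p.Carrier B where
  hom x := φ.comp (p.germ x)
  injective x := h.injective.comp (p.germ_injective x)
  hom_smul k x T := congrArg φ (p.germ_smul k x T)
  dense := by
    refine h.denseRange.mono ?_
    rintro _ ⟨s, rfl⟩
    obtain ⟨x, T, rfl⟩ := p.exists_germ_eq s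
    exact ⟨x, T, rfl⟩

/-- Transport of a system of embeddings of `𝒦` along an isomorphism of actions. -/
def FrobSystem.comapEquiv {X Y B : Type*} [MulAction ℕ+ X] [MulAction ℕ+ Y]
    [NonUnitalCStarAlgebra B] (Φ : FrobSystem Y B) (g : X ≃ Y)
    (hg : ∀ (k : ℕ+) (x : X), g (k • x) = k • g x) : FrobSystem X B where
  hom x := Φ.hom (g x)
  injective x := Φ.injective (g x)
  hom_smul k x T := by rw [hg, Φ.hom_smul]
  dense := by
    refine Φ.dense.mono ?_
    rintro _ ⟨y, T, rfl⟩
    exact ⟨g.symm y, T, by rw [g.apply_symm_apply]⟩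

end StalkCompletion

theorem proposition7p3 :
    ∃ S : InvolutiveAlgebraObj compactPresheaf, IsOperatorAlgebraObj S ∧
      (∀ p : NTimesPoint, IsPreCStarAlgebra (S.Stalk p) ∧
        ∀ (B : Type) [NonUnitalCStarAlgebra B], IsCompletedBy (S.Stalk p) B →
          IsInfiniteSeparableMatroid B) ∧
      (∀ (A : Type u) [NonUnitalCStarAlgebra A], IsInfiniteSeparableMatroid A →
        ∃ p : NTimesPoint, IsCompletedBy (S.Stalk p) A ∧
          ∀ q : NTimesPoint, IsCompletedBy (S.Stalk q) A →
            Nonempty (CategoryTheory.Iso q p)) := by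
  refine ⟨operatorAlgebraObj, isOperatorAlgebraObj_operatorAlgebraObj, fun p =>
    ⟨p.exists_isCStarCompletion, fun B _ ⟨φ, hφ⟩ =>
      hφ.frobSystem.isInfiniteSeparableMatroid p.isFlatAction⟩, fun A _ hA => ?_⟩
  obtain ⟨X, _, hX, hlimit⟩ := hA.exists_flat
  obtain ⟨B, _, φ, hφ⟩ := hX.toPoint.exists_isCStarCompletion
  obtain ⟨e⟩ := hlimit B (hφ.frobSystem.comapEquiv hX.carrierEquiv hX.carrierEquiv_smul)
  have hp := hφ.trans_starAlgEquiv e.symm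
  refine ⟨hX.toPoint, ⟨_, hp⟩, fun q ⟨ψ, hψ⟩ => ?_⟩
  obtain ⟨f, hf⟩ :=
    hp.frobSystem.exists_equiv hψ.frobSystem hX.toPoint.isFlatAction q.isFlatAction
  exact NTimesPoint.nonempty_iso_of_equiv f hf
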